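/- **Definitions.** A schema $\mathbf S$ is a finite set of relation symbols, each with an arity $\ge 0$. An $\mathbf S$-instance is a finite set of facts $R(a_1,\dots,a_r)$ with $R\in\mathbf S$ of arity $r$; its active domain $\mathrm{adom}(I)$ is the set of values occurring in its facts. A homomorphism $I\to J$ is a map $\mathrm{adom}(I)\to\mathrm{adom}(J)$ sending facts of $I$ to facts of $J$. A pointed instance $(I,a_1,\dots,a_n)$ is an instance $I$ with $a_1,\dots,a_n\in\mathrm{adom}(I)$; homomorphisms of pointed instances also send the $i$-th distinguished element to the $i$-th one. The incidence graph of $I$ is the bipartite multigraph whose nodes are the elements of $\mathrm{adom}(I)$ and the facts of $I$, with one edge between $a$ and $f$ for every occurrence of $a$ in $f$; $I$, or a pointed instance $(I,\mathbf a)$, is acyclic if this multigraph has no cycle (parallel edges count as a cycle). MSO formulas over $\mathbf S$ are evaluated in $I$ with element and set quantifiers ranging over elements and subsets of $\mathrm{adom}(I)$. A Datalog program $P$ consists of pairwise disjoint schemas $\mathbf S_{in},\mathbf S_{out},\mathbf S_{aux}$ and a finite set of rules $R_0(\mathbf x_0) \leftarrow R_1(\mathbf x_1),\dots,R_m(\mathbf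 x_m)$ with $m\ge 0$, $R_0\in\mathbf S_{out}\cup\mathbf S_{aux}$, $R_1,\dots,R_m\in\mathbf S_{in}\cup\mathbf S_{aux}$, where every variable of the head $R_0(\mathbf x_0)$ occurs in the body. For an $\mathbf S_{in}$-instance $I$, $P(I)$ is the set of $\mathbf S_{out}$-facts derivable from $I$ by repeatedly applying the rules. $P$ is tree-shaped if, for each rule, the instance whose facts are the atoms of the rule body is acyclic. $P$ is almost monadic if one can choose for each $R\in\mathbf S_{aux}$ at most one argument position, its articulation position (the other positions being non-articulation positions), such that in every rule, each variable occurring in a non-articulation position of an auxiliary relation in the body occurs only once in the body and does not occur in the articulation position of an auxiliary relation in the head. A TAM Datalog program is a tree-shaped, almost monadic Datalog program. An MSO formula $\varphi(x_1,\dots,x_n)$ over $\mathbf S_{in}$ is definable by $P$ if there is an $n$-ary $R\in\mathbf S_{out}$ such that for all $\mathbf S_{in}$-instances $I$ and $a_1,\dots,a_n\in\mathrm{adom}(I)$: $R(a_1,\dots,a_n)\in P(I)$ iff $I\models\varphi(a_1,\dots,a_n)$. **Theorem.** Let $n\ge 0$ and let $\varphi(x_1,\dots,x_n)$ be an MSO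 formula over a schema $\mathbf S_{in}$. The following are equivalent: 1. $\varphi$ is definable by a TAM Datalog program with input schema $\mathbf S_{in}$; 2. $\varphi$ is definable by a tree-shaped Datalog program with input schema $\mathbf S_{in}$; 3. $\varphi$ is tree-determined: for every pointed $\mathbf S_{in}$-instance $(I,a_1,\dots,a_n)$, $I\models\varphi(a_1,\dots,a_n)$ if and only if there is an acyclic pointed $\mathbf S_{in}$-instance $(J,b_1,\dots,b_n)$ with $J\models\varphi(b_1,\dots,b_n)$ and a homomorphism $(J,b_1,\dots,b_n)\to(I,a_1,\dots,a_n)$. -/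

import Mathlib

/-- A schema: finitely many relation symbols, each with an arity `≥ 0`. -/
structure Schema where
  Rel : Type
  finite : Finite Rel
  arity : Rel → ℕ

/-- The disjoint union of two schemas. -/
def Schema.sum (S T : Schema) : Schema where
  Rel := S.Rel ⊕ T.Rel
  finite := by
    have := S.finite
    have := T.finite
    infer_instance
  arity := Sum.elim S.arity T.arity

/-- A fact `R(a₁, …, a_k)` with values in `α` (an atom, when `α` is a type of variables). -/
structure RelFact (S : Schema) (α : Type) where
  rel : S.Rel
  args : Fin (S.arity rel) → α

/-- Applying a function to all arguments of a fact. -/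
def RelFact.map {S : Schema} {α β : Type} (h : α → β) (f : RelFact S α) : RelFact S β :=
  ⟨f.rel, fun i => h (f.args i)⟩

/-- An `S`-instance: a finite set of facts. -/
structure Instance (S : Schema) (α : Type) where
  facts : Set (RelFact S α)
  finite : facts.Finite

namespace Instance

variable {S : Schema} {α β : Type}

/-- The active domain: the values occurring in the facts. -/
def adom (I : Instance S α) : Set α :=
  {a | ∃ f ∈ I.facts, ∃ i, f.args i = a}

/-- An argument of a fact of `I`, as an element of the active domain. -/
def arg (I : Instance S α) (f : I.facts) (i : Fin (S.arity f.1.rel)) : I.adom :=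
  ⟨f.1.args i, f.1, f.2, i, rfl⟩

/-- A homomorphism `I → J`: a map `adom(I) → adom(J)` sending facts of `I` to facts of `J`. -/
structure Hom (I : Instance S α) (J : Instance S β) where
  toFun : I.adom → J.adom
  map_fact : ∀ f : I.facts,
    (⟨f.1.rel, fun i => (toFun (I.arg f i)).1⟩ : RelFact S β) ∈ J.facts

/-- The simple graph underlying the (bipartite) incidence multigraph: the nodes are the elements of
the active domain and the facts, and an element is adjacent to the facts in which it occurs. -/
def incidenceGraph (I : Instance S α) : SimpleGraph (I.adom ⊕ I.facts) :=
  SimpleGraph.fromRel fun x y =>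
    ∃ (f : I.facts) (i : Fin (S.arity f.1.rel)), x = Sum.inl (I.arg f i) ∧ y = Sum.inr f

/-- The incidence multigraph has one edge between `a` and `f` for each occurrence of `a` in `f`.
It is acyclic iff it has no parallel edges (these form a cycle of length two), that is, no fact
has a repeated argument, and the underlying simple graph is acyclic. -/
def Acyclic (I : Instance S α) : Prop :=
  (∀ f ∈ I.facts, Function.Injective f.args) ∧ I.incidenceGraph.IsAcyclic

end Instance

/-- Formulas of monadic second-order logic over `S` with free element variables indexed by `Fin n`
and free set variables indexed by `Fin m`. A quantifier binds the variable with the last index. -/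
inductive MSO (S : Schema) : ℕ → ℕ → Type
  | rel {n m : ℕ} (R : S.Rel) (x : Fin (S.arity R) → Fin n) : MSO S n m
  | eq {n m : ℕ} (x y : Fin n) : MSO S n m
  | mem {n m : ℕ} (x : Fin n) (X : Fin m) : MSO S n m
  | neg {n m : ℕ} (φ : MSO S n m) : MSO S n m
  | and {n m : ℕ} (φ ψ : MSO S n m) : MSO S n m
  | or {n m : ℕ} (φ ψ : MSO S n m) : MSO S n m
  | exElem {n m : ℕ} (φ : MSO S (n + 1) m) : MSO S n m
  | allElem {n m : ℕ} (φ : MSO S (n + 1) m) : MSO S n m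
  | exSet {n m : ℕ} (φ : MSO S n (m + 1)) : MSO S n m
  | allSet {n m : ℕ} (φ : MSO S n (m + 1)) : MSO S n m

/-- Satisfaction; all quantifiers range over (subsets of) the active domain. -/
def MSO.Realize {S : Schema} {α : Type} (I : Instance S α) :
    {n m : ℕ} → MSO S n m → (Fin n → I.adom) → (Fin m → Set I.adom) → Prop
  | _, _, .rel R x, v, _ => (⟨R, fun i => (v (x i)).1⟩ : RelFact S α) ∈ I.facts
  | _, _, .eq x y, v, _ => v x = v y
  | _, _, .mem x X, v, V => v x ∈ V X
  | _, _, .neg φ, v, V => ¬ φ.Realize I v V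
  | _, _, .and φ ψ, v, V => φ.Realize I v V ∧ ψ.Realize I v V
  | _, _, .or φ ψ, v, V => φ.Realize I v V ∨ ψ.Realize I v V
  | _, _, .exElem φ, v, V => ∃ a : I.adom, φ.Realize I (Fin.snoc (α := fun _ => I.adom) v a) V
  | _, _, .allElem φ, v, V => ∀ a : I.adom, φ.Realize I (Fin.snoc (α := fun _ => I.adom) v a) V
  | _, _, .exSet φ, v, V =>
      ∃ A : Set I.adom, φ.Realize I v (Fin.snoc (α := fun _ => Set I.adom) V A)
  | _, _, .allSet φ, v, V =>
      ∀ A : Set I.adom, φ.Realize I v (Fin.snoc (α := fun _ => Set I.adom) V A)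

/-- A `k`-ary MSO query: an MSO formula whose free variables are the element variables
`x₁, …, x_k`. -/
abbrev MSOQuery (S : Schema) (k : ℕ) : Type := MSO S k 0

/-- `I ⊨ φ(a₁, …, a_k)`. -/
def MSOQuery.Holds {S : Schema} {k : ℕ} (φ : MSOQuery S k) {α : Type} (I : Instance S α)
    (a : Fin k → I.adom) : Prop :=
  MSO.Realize I φ a Fin.elim0

/-- A Datalog rule `R₀(x₀) :- R₁(x₁), …, R_n(x_n)` with `n ≥ 0`. `Var` is the type of the variables
of the rule; all of them, in particular those of the head, occur in the body. -/
structure DatalogRule (Sin Sout Saux : Schema) where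
  Var : Type
  head : RelFact (Sout.sum Saux) Var
  body : List (RelFact (Sin.sum Saux) Var)
  safe : ∀ x : Var, ∃ A ∈ body, ∃ i, A.args i = x

/-- The (instance underlying the) canonical instance of a rule: its facts are the conjuncts of the
rule body. -/
def DatalogRule.canonicalInstance {Sin Sout Saux : Schema} (r : DatalogRule Sin Sout Saux) :
    Instance (Sin.sum Saux) r.Var where
  facts := {A | A ∈ r.body}
  finite := r.body.finite_toSet

/-- A Datalog program with input schema `Sin`. -/
structure DatalogProgram (Sin : Schema) where
  Sout : Schema
  Saux : Schema
  rules : Set (DatalogRule Sin Sout Saux)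
  finite : rules.Finite

namespace DatalogProgram

variable {Sin : Schema} {α : Type}

/-- The union of the input, output and auxiliary schemas. -/
def full (P : DatalogProgram Sin) : Schema := Sin.sum (P.Sout.sum P.Saux)

/-- An input fact as a fact over the full schema. -/
def ofIn (P : DatalogProgram Sin) (f : RelFact Sin α) : RelFact P.full α :=
  ⟨Sum.inl f.rel, f.args⟩

/-- A fact over `Sin ∪ Saux` as a fact over the full schema. -/
def ofBody (P : DatalogProgram Sin) : RelFact (Sin.sum P.Saux) α → RelFact P.full α
  | ⟨.inl R, x⟩ => ⟨Sum.inl R, x⟩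
  | ⟨.inr R, x⟩ => ⟨Sum.inr (Sum.inr R), x⟩

/-- A fact over `Sout ∪ Saux` as a fact over the full schema. -/
def ofHead (P : DatalogProgram Sin) (f : RelFact (P.Sout.sum P.Saux) α) : RelFact P.full α :=
  ⟨Sum.inr f.rel, f.args⟩

/-- The facts derivable from facts in `K` by one application of a rule. -/
def derived (P : DatalogProgram Sin) (K : Set (RelFact P.full α)) : Set (RelFact P.full α) :=
  {f | ∃ r ∈ P.rules, ∃ σ : r.Var → α,
    (∀ A ∈ r.body, P.ofBody (A.map σ) ∈ K) ∧ f = P.ofHead (r.head.map σ)}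

/-- The `i`-th stage of the chase. -/
def chaseStage (P : DatalogProgram Sin) (I : Instance Sin α) : ℕ → Set (RelFact P.full α)
  | 0 => P.ofIn '' I.facts
  | i + 1 => P.chaseStage I i ∪ P.derived (P.chaseStage I i)

/-- The chase: the union of all stages. -/
def chase (P : DatalogProgram Sin) (I : Instance Sin α) : Set (RelFact P.full α) :=
  ⋃ i, P.chaseStage I i

/-- `P(I)`: the facts of the chase over the output schema. -/
def output (P : DatalogProgram Sin) (I : Instance Sin α) : Set (RelFact P.Sout α) :=
  {f | (⟨Sum.inr (Sum.inl f.rel), f.args⟩ : RelFact P.full α) ∈ P.chase I}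

/-- Every rule body has an acyclic incidence graph. -/
def TreeShaped (P : DatalogProgram Sin) : Prop :=
  ∀ r ∈ P.rules, r.canonicalInstance.Acyclic

end DatalogProgram

/-- A partial function assigning to relation symbols one of their argument positions. -/
abbrev ArticulationFunction (Saux : Schema) : Type :=
  (R : Saux.Rel) → Option (Fin (Saux.arity R))

namespace ArticulationFunction

variable {Saux : Schema}

/-- In a schema `S ∪ Saux`: `R` is an auxiliary relation and `i` is its articulation position. -/
def IsArticulation (f : ArticulationFunction Saux) {S : Schema} :
    (R : (S.sum Saux).Rel) → Fin ((S.sum Saux).arity R) → Prop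
  | .inl _, _ => False
  | .inr R, i => f R = some i

/-- In a schema `S ∪ Saux`: `R` is an auxiliary relation and `i` is one of its non-articulation
positions. -/
def IsNonArticulation (f : ArticulationFunction Saux) {S : Schema} :
    (R : (S.sum Saux).Rel) → Fin ((S.sum Saux).arity R) → Prop
  | .inl _, _ => False
  | .inr R, i => f R ≠ some i

end ArticulationFunction

/-- The occurrences of variables in a rule body: an index of a conjunct and an argument position. -/
abbrev DatalogRule.Occurrence {Sin Sout Saux : Schema} (r : DatalogRule Sin Sout Saux) : Type :=
  (k : Fin r.body.length) × Fin ((Sin.sum Saux).arity (r.body.get k).rel)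

/-- The variable at an occurrence. -/
def DatalogRule.varAt {Sin Sout Saux : Schema} (r : DatalogRule Sin Sout Saux)
    (o : r.Occurrence) : r.Var :=
  (r.body.get o.1).args o.2

/-- There is an articulation function such that in every rule, each variable occurring in a
non-articulation position of an auxiliary relation in the body occurs only once in the body, and
does not occur in the articulation position of an auxiliary relation in the head. -/
def DatalogProgram.AlmostMonadic {Sin : Schema} (P : DatalogProgram Sin) : Prop :=
  ∃ f : ArticulationFunction P.Saux, ∀ r ∈ P.rules, ∀ o : r.Occurrence,
    f.IsNonArticulation (r.body.get o.1).rel o.2 →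
      (∀ o' : r.Occurrence, r.varAt o' = r.varAt o → o' = o) ∧
      (∀ i, f.IsArticulation r.head.rel i → r.head.args i ≠ r.varAt o)

/-- A tree-shaped almost-monadic Datalog program. -/
def DatalogProgram.IsTAM {Sin : Schema} (P : DatalogProgram Sin) : Prop :=
  P.TreeShaped ∧ P.AlmostMonadic

/-- `P` together with the `k`-ary output relation `R` defines the query `φ`. -/
def DatalogProgram.Defines {Sin : Schema} (P : DatalogProgram Sin) {k : ℕ} (R : P.Sout.Rel)
    (hR : P.Sout.arity R = k) (φ : MSOQuery Sin k) : Prop :=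
  ∀ (α : Type) (I : Instance Sin α) (a : Fin k → I.adom),
    (⟨R, fun i => (a (Fin.cast hR i)).1⟩ : RelFact P.Sout α) ∈ P.output I ↔ φ.Holds I a

/-- `φ` is defined by some Datalog program of the class `C` with a designated output relation. -/
def MSOQuery.DefinableIn {Sin : Schema} {k : ℕ} (φ : MSOQuery Sin k)
    (C : DatalogProgram Sin → Prop) : Prop :=
  ∃ P : DatalogProgram Sin, C P ∧ ∃ (R : P.Sout.Rel) (hR : P.Sout.arity R = k), P.Defines R hR φ

/-- `φ` holds at a pointed instance iff an acyclic pointed instance at which `φ` holds maps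
homomorphically to it. -/
def MSOQuery.TreeDetermined {S : Schema} {k : ℕ} (φ : MSOQuery S k) : Prop :=
  ∀ (α : Type) (I : Instance S α) (a : Fin k → I.adom),
    φ.Holds I a ↔
      ∃ (β : Type) (J : Instance S β) (b : Fin k → J.adom),
        J.Acyclic ∧ φ.Holds J b ∧ ∃ h : J.Hom I, ∀ i, h.toFun (b i) = a i

/-! A TAM program is tree-shaped, so two implications carry the content.

From a tree-shaped program to tree-determinacy: derivability is preserved by homomorphisms
(`map_hom_mem_chase`). Conversely, a derivation can be unravelled (`exists_forest`): each input fact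
is replaced by a fresh copy with distinct arguments, and the forests found for the atoms of a rule
body are glued along that body. As the body is acyclic, the result is a forest; it maps to the
input, and a preimage of the derived fact is derived on it.

From tree-determinacy to a TAM program: the program computes MSO types. For each rank there are
finitely many types (`Tp.finite`), types of rank at least that of the formula decide it
(`MSO.realize_of_tp_eq`), and the type of a disjoint union with at most one extra fact on the roots
of the parts depends only on the types of the parts (`tp_join_eq`). The program has one auxiliary
relation for each type of instances with `n + 1` points. Point `0` is the root and fills the
articulation position; the other points are merely carried along, so the program is almost monadic.

Every type derived on an input is realized by a forest mapping to the input
(`soundFact_of_mem_chase`), so tree-determinacy makes all outputs correct. Every forest with chosen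
points is assembled by the joins (`built_of_forest`), so all answers are output on forests, and
homomorphisms carry them to arbitrary instances.

Acyclicity is used throughout as `Forest`: removing a fact separates its arguments. To verify it,
one finds a map that is constant on the remaining facts (`Conn.eq_of_const`) or respects their
connectivity (`Conn.map`). -/

theorem RelFact.map_map {S : Schema} {α β γ : Type} (g : β → γ) (h : α → β) (f : RelFact S α) :
    (f.map h).map g = f.map (g ∘ h) := rfl

theorem RelFact.map_injective {S : Schema} {α β : Type} {h : α → β} (hh : Function.Injective h) :
    Function.Injective (RelFact.map (S := S) h) := by
  rintro ⟨R, x⟩ ⟨R', x'⟩ e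
  simp only [RelFact.map, RelFact.mk.injEq] at e
  obtain ⟨rfl, e⟩ := e
  simp only [heq_eq_eq] at e
  congr 1
  funext i
  exact hh (congrFun e i)

theorem RelFact.exists_of_map_eq {S : Schema} {α β : Type} {h : α → β} {f : RelFact S α}
    {g : RelFact S β} (e : f.map h = g) :
    ∃ x : Fin (S.arity g.rel) → α, f = ⟨g.rel, x⟩ ∧ ∀ i, h (x i) = g.args i := by
  subst e
  exact ⟨f.args, rfl, fun _ => rfl⟩

/-! ### Connectivity and acyclicity of sets of facts -/

section Forest

variable {S T : Schema} {α β γ : Type}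

/-- Two values are linked by a fact of `F`. -/
def Linked (F : Set (RelFact S α)) (a b : α) : Prop :=
  ∃ f ∈ F, ∃ i j, f.args i = a ∧ f.args j = b

/-- The equivalence relation generated by `Linked`. -/
def Conn (F : Set (RelFact S α)) : α → α → Prop := Relation.EqvGen (Linked F)

theorem Conn.refl (F : Set (RelFact S α)) (a : α) : Conn F a a := Relation.EqvGen.refl a

theorem Conn.symm {F : Set (RelFact S α)} {a b : α} (h : Conn F a b) : Conn F b a :=
  Relation.EqvGen.symm _ _ h

theorem Conn.trans {F : Set (RelFact S α)} {a b c : α} (h : Conn F a b) (h' : Conn F b c) :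
    Conn F a c := Relation.EqvGen.trans _ _ _ h h'

theorem Conn.of_mem {F : Set (RelFact S α)} {f : RelFact S α} (hf : f ∈ F)
    (i j : Fin (S.arity f.rel)) : Conn F (f.args i) (f.args j) :=
  Relation.EqvGen.rel _ _ ⟨f, hf, i, j, rfl, rfl⟩

theorem Conn.map {F : Set (RelFact S α)} {G : Set (RelFact T β)} (r : α → β)
    (hr : ∀ f ∈ F, ∀ i j, Conn G (r (f.args i)) (r (f.args j))) {a b : α} (h : Conn F a b) :
    Conn G (r a) (r b) := by
  induction h with
  | rel a b h =>
    obtain ⟨f, hf, i, j, rfl, rfl⟩ := h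
    exact hr f hf i j
  | refl a => exact Conn.refl _ _
  | symm a b _ ih => exact ih.symm
  | trans a b c _ _ ih ih' => exact ih.trans ih'

/-- A function that is constant on each fact is constant on connected components. -/
theorem Conn.eq_of_const {F : Set (RelFact S α)} (r : α → γ)
    (hr : ∀ f ∈ F, ∀ i j, r (f.args i) = r (f.args j)) {a b : α} (h : Conn F a b) :
    r a = r b := by
  induction h with
  | rel a b h =>
    obtain ⟨f, hf, i, j, rfl, rfl⟩ := h
    exact hr f hf i j
  | refl a => rfl
  | symm a b _ ih => exact ih.symm
  | trans a b c _ _ ih ih' => exact ih.trans ih'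

/-- The arguments of each fact lie in pairwise different components after its removal. -/
def Forest (F : Set (RelFact S α)) : Prop :=
  ∀ f ∈ F, ∀ i j, Conn (F \ {f}) (f.args i) (f.args j) → i = j

theorem Forest.mono {F G : Set (RelFact S α)} (hG : Forest G) (h : F ⊆ G) : Forest F := by
  intro f hf i j hij
  refine hG f (h hf) i j (hij.map id ?_)
  intro g hg i j
  exact Conn.of_mem (F := G \ {f}) ⟨h hg.1, hg.2⟩ i j

/-- Every edge of an acyclic graph is a bridge. If the other facts connected two distinct arguments
of `f`, a path through them followed by the edge from the `j`-th argument to `f` would bypass the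
edge from the `i`-th argument to `f`. -/
theorem Instance.Acyclic.forest {I : Instance S α} (hI : I.Acyclic) : Forest I.facts := by
  classical
  intro f hf i j hij
  by_contra hne
  have hab : f.args i ≠ f.args j := fun h => hne (hI.1 f hf h)
  have hadj : ∀ (g : I.facts) k, I.incidenceGraph.Adj (Sum.inl (I.arg g k)) (Sum.inr g) := by
    intro g k
    refine (SimpleGraph.fromRel_adj _ _ _).2 ⟨by simp, Or.inl ⟨g, k, rfl, rfl⟩⟩
  have hbr := SimpleGraph.isAcyclic_iff_forall_adj_isBridge.1 hI.2 (hadj ⟨f, hf⟩ i)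
  rw [SimpleGraph.isBridge_iff] at hbr
  set e : Sym2 (I.adom ⊕ I.facts) := s(Sum.inl (I.arg ⟨f, hf⟩ i), Sum.inr ⟨f, hf⟩) with he
  have hadj' : ∀ (g : I.facts) k, s(Sum.inl (I.arg g k), Sum.inr g) ≠ e →
      (I.incidenceGraph.deleteEdges {e}).Adj (Sum.inl (I.arg g k)) (Sum.inr g) := by
    intro g k h
    rw [SimpleGraph.deleteEdges_adj]
    exact ⟨hadj g k, by simpa using h⟩
  set G := I.incidenceGraph.deleteEdges {e} with hG
  have key : G.Reachable (Sum.inl (I.arg ⟨f, hf⟩ i)) (Sum.inl (I.arg ⟨f, hf⟩ j)) := by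
    -- The invariant is the connected component after deletion of the edge; values outside the
    -- active domain get the default `none`.
    have := hij.eq_of_const
      (fun x => if h : x ∈ I.adom then some (G.connectedComponentMk (Sum.inl ⟨x, h⟩)) else none) ?_
    · have h1 : f.args i ∈ I.adom := ⟨f, hf, i, rfl⟩
      have h2 : f.args j ∈ I.adom := ⟨f, hf, j, rfl⟩
      simp only [h1, h2, dite_true, Option.some.injEq] at this
      exact SimpleGraph.ConnectedComponent.exact this
    · intro g hg k l
      have hgf : ∀ k, s(Sum.inl (I.arg ⟨g, hg.1⟩ k), Sum.inr ⟨g, hg.1⟩) ≠ e := by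
        intro k h
        have : g = f := by
          exact (show I.arg ⟨g, hg.1⟩ k = I.arg ⟨f, hf⟩ i ∧ g = f by simpa [he] using h).2
        exact hg.2 this
      have h1 : ∀ k, g.args k ∈ I.adom := fun k => ⟨g, hg.1, k, rfl⟩
      simp only [h1, dite_true, Option.some.injEq]
      refine SimpleGraph.ConnectedComponent.sound ?_
      exact (hadj' ⟨g, hg.1⟩ k (hgf k)).reachable.trans
        (hadj' ⟨g, hg.1⟩ l (hgf l)).symm.reachable
  refine hbr (key.trans (hadj' ⟨f, hf⟩ j ?_).reachable)
  intro h
  have : I.arg ⟨f, hf⟩ j = I.arg ⟨f, hf⟩ i := by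
    simpa [he] using h
  exact hab (congrArg Subtype.val this).symm

theorem Forest.acyclic {I : Instance S α} (hI : Forest I.facts) : I.Acyclic := by
  refine ⟨fun f hf i j h => hI f hf i j (h ▸ Conn.refl _ _), ?_⟩
  rw [SimpleGraph.isAcyclic_iff_forall_adj_isBridge]
  have main : ∀ (f : I.facts) i, I.incidenceGraph.IsBridge
      s(Sum.inl (I.arg f i), Sum.inr f) := by
    intro f i
    rw [SimpleGraph.isBridge_iff]
    intro hr
    -- `χ` marks the side of the `i`-th argument of `f` and puts `f` itself on the other side. Every
    -- edge except the deleted one respects it: at `f`, this is the forest property.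
    let χ : I.adom ⊕ I.facts → Prop := Sum.elim
      (fun x => Conn (I.facts \ {f.1}) x.1 (f.1.args i))
      (fun g => g ≠ f ∧ ∃ k, Conn (I.facts \ {f.1}) (g.1.args k) (f.1.args i))
    have step : ∀ (g : I.facts) k,
        s((Sum.inl (I.arg g k) : I.adom ⊕ I.facts), Sum.inr g) ≠ s(Sum.inl (I.arg f i), Sum.inr f) →
        (χ (Sum.inl (I.arg g k)) ↔ χ (Sum.inr g)) := by
      intro g k hne
      by_cases hgf : g = f
      · subst hgf
        simp only [χ, Sum.elim_inl, Sum.elim_inr, ne_eq, not_true, false_and, iff_false]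
        intro h
        have := hI g.1 g.2 k i h
        subst this
        exact hne rfl
      · have hg : g.1 ∈ I.facts \ {f.1} := ⟨g.2, fun h => hgf (Subtype.ext h)⟩
        simp only [χ, Sum.elim_inl, Sum.elim_inr, ne_eq, hgf, not_false_eq_true, true_and]
        exact ⟨fun h => ⟨k, h⟩, fun ⟨l, h⟩ => (Conn.of_mem hg k l).trans h⟩
    have inv : ∀ x y, (I.incidenceGraph.deleteEdges {s(Sum.inl (I.arg f i), Sum.inr f)}).Adj x y →
        (χ x ↔ χ y) := by
      intro x y h
      rw [SimpleGraph.deleteEdges_adj] at h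
      obtain ⟨h, hne⟩ := h
      rcases ((SimpleGraph.fromRel_adj _ _ _).1 h).2 with ⟨g, k, rfl, rfl⟩ | ⟨g, k, rfl, rfl⟩
      · exact step g k hne
      · exact (step g k (by rwa [Sym2.eq_swap])).symm
    obtain ⟨w⟩ := hr
    have walk : ∀ x y, (I.incidenceGraph.deleteEdges
        {s(Sum.inl (I.arg f i), Sum.inr f)}).Walk x y → (χ x ↔ χ y) := by
      intro x y w
      induction w with
      | nil => rfl
      | cons h _ ih => exact (inv _ _ h).trans ih
    have := (walk _ _ w).1 (Conn.refl _ _)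
    exact this.1 rfl
  intro x y h
  rcases ((SimpleGraph.fromRel_adj _ _ _).1 h).2 with ⟨f, i, rfl, rfl⟩ | ⟨f, i, rfl, rfl⟩
  · exact main f i
  · rw [Sym2.eq_swap]
    exact main f i

end Forest

/-! ### The chase -/

namespace DatalogProgram

variable {Sin : Schema} {α β : Type} (P : DatalogProgram Sin)

theorem derived_mono {K L : Set (RelFact P.full α)} (h : K ⊆ L) : P.derived K ⊆ P.derived L := by
  rintro f ⟨r, hr, σ, hσ, rfl⟩
  exact ⟨r, hr, σ, fun A hA => h (hσ A hA), rfl⟩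

theorem chaseStage_mono (I : Instance Sin α) : Monotone (P.chaseStage I) :=
  monotone_nat_of_le_succ fun _ => Set.subset_union_left

theorem ofIn_mem_chase {I : Instance Sin α} {f : RelFact Sin α} (hf : f ∈ I.facts) :
    P.ofIn f ∈ P.chase I :=
  Set.mem_iUnion.2 ⟨0, f, hf, rfl⟩

/-- The chase is closed under rule applications. -/
theorem head_mem_chase {I : Instance Sin α} {r : DatalogRule Sin P.Sout P.Saux} (hr : r ∈ P.rules)
    (σ : r.Var → α) (h : ∀ A ∈ r.body, P.ofBody (A.map σ) ∈ P.chase I) :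
    P.ofHead (r.head.map σ) ∈ P.chase I := by
  -- The body is finite and the stages increase, so a single stage contains all its atoms.
  have hex : ∃ k, ∀ A ∈ r.body, P.ofBody (A.map σ) ∈ P.chaseStage I k := by
    generalize r.body = l at h
    induction l with
    | nil => exact ⟨0, by simp⟩
    | cons A l ih =>
      obtain ⟨k, hk⟩ := ih fun A hA => h A (List.mem_cons_of_mem _ hA)
      obtain ⟨m, hm⟩ := Set.mem_iUnion.1 (h A List.mem_cons_self)
      refine ⟨max k m, fun B hB => ?_⟩
      rcases List.mem_cons.1 hB with rfl | hB
      · exact P.chaseStage_mono I (le_max_right _ _) hm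
      · exact P.chaseStage_mono I (le_max_left _ _) (hk B hB)
  obtain ⟨k, hk⟩ := hex
  exact Set.mem_iUnion.2 ⟨k + 1, Or.inr ⟨r, hr, σ, hk, rfl⟩⟩

/-- The chase is the least set containing the input and closed under rule applications. -/
theorem chase_subset {I : Instance Sin α} {C : Set (RelFact P.full α)}
    (h0 : ∀ f ∈ I.facts, P.ofIn f ∈ C) (h1 : P.derived C ⊆ C) : P.chase I ⊆ C := by
  refine Set.iUnion_subset fun k => ?_
  induction k with
  | zero =>
    rintro _ ⟨f, hf, rfl⟩
    exact h0 f hf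
  | succ k ih => exact Set.union_subset ih ((P.derived_mono ih).trans h1)

theorem ofBody_map (h : α → β) (f : RelFact (Sin.sum P.Saux) α) :
    (P.ofBody f).map h = P.ofBody (f.map h) := by
  rcases f with ⟨R | R, x⟩ <;> rfl

theorem ofBody_arg_mem {C : Set α} {f : RelFact (Sin.sum P.Saux) α}
    (h : ∀ i, (P.ofBody f).args i ∈ C) (i : Fin ((Sin.sum P.Saux).arity f.rel)) : f.args i ∈ C := by
  rcases f with ⟨R | R, x⟩ <;> exact h i

theorem exists_ofBody_of_map_eq {h : β → α} {g : RelFact P.full β}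
    {A : RelFact (Sin.sum P.Saux) α} (hg : g.map h = P.ofBody A) :
    ∃ b : Fin ((Sin.sum P.Saux).arity A.rel) → β, g = P.ofBody ⟨A.rel, b⟩ ∧
      ∀ i, h (b i) = A.args i := by
  obtain ⟨b, hb, hb'⟩ := RelFact.exists_of_map_eq hg
  rcases A with ⟨R | R, x⟩ <;> exact ⟨b, hb, hb'⟩

theorem args_mem_adom_of_mem_chase {I : Instance Sin α} {f : RelFact P.full α}
    (hf : f ∈ P.chase I) (i) : f.args i ∈ I.adom := by
  revert i
  refine P.chase_subset (C := {f | ∀ i, f.args i ∈ I.adom}) ?_ ?_ hf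
  · exact fun f hf i => ⟨f, hf, i, rfl⟩
  · rintro _ ⟨r, -, σ, hσ, rfl⟩ i
    obtain ⟨A, hA, j, hj⟩ := r.safe (r.head.args i)
    have := P.ofBody_arg_mem (hσ A hA) j
    simp only [RelFact.map, hj] at this
    exact this

theorem map_mem_chase {I : Instance Sin α} {J : Instance Sin β} {h : α → β}
    (hh : ∀ f ∈ I.facts, f.map h ∈ J.facts) {f : RelFact P.full α} (hf : f ∈ P.chase I) :
    f.map h ∈ P.chase J := by
  refine P.chase_subset (C := {f | f.map h ∈ P.chase J}) ?_ ?_ hf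
  · exact fun f hf => P.ofIn_mem_chase (hh f hf)
  · rintro _ ⟨r, hr, σ, hσ, rfl⟩
    refine P.head_mem_chase hr (h ∘ σ) fun A hA => ?_
    have := hσ A hA
    rw [Set.mem_ofPred_eq, ofBody_map] at this
    exact this

/-- A homomorphism is defined only on the active domain. The chase never leaves it, because rules
are safe; hence it can be carried out in the copy `I'` of `I` over the subtype, where the
homomorphism is a total map. -/
theorem map_hom_mem_chase {I : Instance Sin α} {J : Instance Sin β} (h : I.Hom J)
    {f : RelFact P.full I.adom} (hf : f.map Subtype.val ∈ P.chase I) :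
    f.map (fun x => (h.toFun x).1) ∈ P.chase J := by
  let I' : Instance Sin I.adom :=
    ⟨{f | f.map Subtype.val ∈ I.facts},
      I.finite.preimage (RelFact.map_injective Subtype.val_injective).injOn⟩
  have h1 : P.chase I ⊆ {f | ∃ g ∈ P.chase I', f = g.map Subtype.val} := by
    refine P.chase_subset ?_ ?_
    · exact fun f hf => ⟨P.ofIn ⟨f.rel, I.arg ⟨f, hf⟩⟩, P.ofIn_mem_chase (I := I') hf, rfl⟩
    · rintro _ ⟨r, hr, σ, hσ, rfl⟩
      have hσ' : ∀ x, σ x ∈ I.adom := by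
        intro x
        obtain ⟨A, hA, j, rfl⟩ := r.safe x
        obtain ⟨g, -, hg⟩ := hσ A hA
        obtain ⟨b, -, hb⟩ := P.exists_ofBody_of_map_eq hg.symm
        have := hb j
        change _ = σ (A.args j) at this
        rw [← this]
        exact (b j).2
      refine ⟨P.ofHead (r.head.map fun x => ⟨σ x, hσ' x⟩), ?_, rfl⟩
      refine P.head_mem_chase hr _ fun A hA => ?_
      obtain ⟨g, hg, hgA⟩ := hσ A hA
      convert hg
      refine RelFact.map_injective Subtype.val_injective ?_
      rw [← hgA, ofBody_map]
      rfl
  obtain ⟨g, hg, e⟩ := h1 hf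
  obtain rfl := RelFact.map_injective Subtype.val_injective e
  exact P.map_mem_chase (I := I') (fun f hf => h.map_fact ⟨_, hf⟩) hg

end DatalogProgram

/-- A map of values sending facts to facts, as a homomorphism. -/
def Instance.Hom.ofMap {S : Schema} {α β : Type} {I : Instance S α} {J : Instance S β} (h : α → β)
    (hh : ∀ f ∈ I.facts, f.map h ∈ J.facts) : I.Hom J where
  toFun x := ⟨h x.1, by
    obtain ⟨f, hf, i, hi⟩ := x.2
    exact ⟨f.map h, hh f hf, i, congrArg h hi⟩⟩
  map_fact f := hh f.1 f.2

/-! ### Gluing instances along a tree -/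

section Glue

variable {S T : Schema} {X : Type} {B : Set (RelFact T X)} {β : B → Type}

/-- The `i`-th distinguished point of the instance attached at `A` is the `i`-th argument of
`A`. -/
inductive GlueRel (b : ∀ A : B, Fin (T.arity A.1.rel) → β A) :
    X ⊕ (Σ A, β A) → X ⊕ (Σ A, β A) → Prop
  | intro (A : B) (i : Fin (T.arity A.1.rel)) :
      GlueRel b (Sum.inr ⟨A, b A i⟩) (Sum.inl (A.1.args i))

/-- The values obtained by attaching to each atom `A ∈ B` the values `β A`. -/
def Glue (b : ∀ A : B, Fin (T.arity A.1.rel) → β A) : Type := Quot (GlueRel b)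

/-- The inclusion of an attached instance. -/
def Glue.mk (b : ∀ A : B, Fin (T.arity A.1.rel) → β A) (A : B) (x : β A) : Glue b :=
  Quot.mk _ (Sum.inr ⟨A, x⟩)

/-- The variables as values of the glued instance. -/
def Glue.var (b : ∀ A : B, Fin (T.arity A.1.rel) → β A) (x : X) : Glue b := Quot.mk _ (Sum.inl x)

theorem Glue.mk_point (b : ∀ A : B, Fin (T.arity A.1.rel) → β A) (A : B)
    (i : Fin (T.arity A.1.rel)) : Glue.mk b A (b A i) = Glue.var b (A.1.args i) :=
  Quot.sound (GlueRel.intro A i)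

/-- The union of the attached instances. -/
def Glue.inst [Finite B] (b : ∀ A : B, Fin (T.arity A.1.rel) → β A)
    (J : ∀ A : B, Instance S (β A)) : Instance S (Glue b) where
  facts := ⋃ A, RelFact.map (Glue.mk b A) '' (J A).facts
  finite := Set.finite_iUnion fun A => (J A).finite.image _

/-- Without `A`, each component of `B` contains at most one argument of `A`. A variable in the
component of the `i`-th argument is sent to the point `b A i`, other variables to `none`. All
arguments of another atom lie in one component, so the part attached there can be collapsed to one
value. -/
theorem Glue.exists_retraction (hB : Forest B) (b : ∀ A : B, Fin (T.arity A.1.rel) → β A) (A : B) :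
    ∃ r : Glue b → Option (β A), (∀ x, r (Glue.mk b A x) = some x) ∧
      ∀ A', A' ≠ A → ∀ x y, r (Glue.mk b A' x) = r (Glue.mk b A' y) := by
  classical
  let ρ : X → Option (β A) := fun v =>
    if h : ∃ i, Conn (B \ {A.1}) v (A.1.args i) then some (b A h.choose) else none
  have ρ_eq : ∀ v i, Conn (B \ {A.1}) v (A.1.args i) → ρ v = some (b A i) := by
    intro v i hi
    have h : ∃ i, Conn (B \ {A.1}) v (A.1.args i) := ⟨i, hi⟩
    simp only [ρ, h, dite_true]
    rw [hB A.1 A.2 _ _ (h.choose_spec.symm.trans hi)]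
  have ρ_conn : ∀ v w, Conn (B \ {A.1}) v w → ρ v = ρ w := by
    intro v w hvw
    by_cases h : ∃ i, Conn (B \ {A.1}) v (A.1.args i)
    · obtain ⟨i, hi⟩ := h
      rw [ρ_eq v i hi, ρ_eq w i (hvw.symm.trans hi)]
    · have h' : ¬ ∃ i, Conn (B \ {A.1}) w (A.1.args i) := fun ⟨i, hi⟩ => h ⟨i, hvw.trans hi⟩
      simp only [ρ, h, h', dite_false]
  -- A part attached at a nullary atom is glued to nothing, so any constant will do.
  let τ : (Σ A', β A') → Option (β A) := fun z =>
    if h : z.1 = A then some (h ▸ z.2) else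
      if h' : 0 < T.arity z.1.1.rel then ρ (z.1.1.args ⟨0, h'⟩) else none
  refine ⟨Quot.lift (Sum.elim ρ τ) ?_, ?_, ?_⟩
  · rintro _ _ ⟨A', i⟩
    by_cases h : A' = A
    · subst h
      simp only [Sum.elim_inr, Sum.elim_inl, τ, dite_true]
      exact (ρ_eq _ i (Conn.refl _ _)).symm
    · have hi : 0 < T.arity A'.1.rel := i.pos
      simp only [Sum.elim_inr, Sum.elim_inl, τ, h, dite_false, hi, dite_true]
      exact ρ_conn _ _ (Conn.of_mem (F := B \ {A.1})
        ⟨A'.2, fun h' => h (Subtype.ext h')⟩ _ _)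
  · intro x
    simp [Glue.mk, τ]
  · intro A' h x y
    simp [Glue.mk, τ, h]

/-- Attaching forests to the atoms of a forest yields a forest. -/
theorem Glue.forest [Finite B] (hB : Forest B) (b : ∀ A : B, Fin (T.arity A.1.rel) → β A)
    (J : ∀ A : B, Instance S (β A)) (hJ : ∀ A, Forest (J A).facts) :
    Forest (Glue.inst b J).facts := by
  intro f hf i j hij
  obtain ⟨A, g, hg, rfl⟩ := Set.mem_iUnion.1 hf
  obtain ⟨r, hr, hr'⟩ := Glue.exists_retraction hB b A
  refine hJ A g hg i j (Quot.eqvGen_exact ?_)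
  -- The invariant is the component, within the part of `A` without `g`, of the retracted value:
  -- other parts collapse to one value, and the remaining facts of this part preserve components.
  have := hij.eq_of_const (fun z => (r z).map (Quot.mk (Linked ((J A).facts \ {g})))) ?_
  · simpa [RelFact.map, hr] using this
  · rintro f' ⟨hf', hne⟩ k l
    obtain ⟨A', g', hg', rfl⟩ := Set.mem_iUnion.1 hf'
    by_cases h : A' = A
    · subst h
      have hgg : g' ≠ g := by
        rintro rfl
        exact hne rfl
      simp only [RelFact.map, hr, Option.map_some, Option.some.injEq]
      exact Quot.eqvGen_sound (Conn.of_mem (F := (J A').facts \ {g}) ⟨hg', hgg⟩ k l)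
    · exact congrArg _ (hr' A' h _ _)

end Glue

/-! ### Tree-shaped programs define tree-determined queries -/

/-- A fact derived by a tree-shaped program is derived on a forest that maps to the input. -/
theorem DatalogProgram.TreeShaped.exists_forest {Sin : Schema} {P : DatalogProgram Sin}
    (hP : P.TreeShaped) {α : Type} {I : Instance Sin α} {f : RelFact P.full α}
    (hf : f ∈ P.chase I) :
    ∃ (β : Type) (J : Instance Sin β) (g : RelFact P.full β) (h : β → α), Forest J.facts ∧
      g ∈ P.chase J ∧ (∀ f ∈ J.facts, f.map h ∈ I.facts) ∧ g.map h = f := by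
  refine P.chase_subset (C := {f | ∃ (β : Type) (J : Instance Sin β) (g : RelFact P.full β)
    (h : β → α), Forest J.facts ∧ g ∈ P.chase J ∧ (∀ f ∈ J.facts, f.map h ∈ I.facts) ∧
      g.map h = f}) ?_ ?_ hf
  · intro f hf
    -- The generic fact has its own positions as arguments, so repeated values of `f` become
    -- distinct.
    let g : RelFact Sin (Fin (Sin.arity f.rel)) := ⟨f.rel, id⟩
    refine ⟨_, ⟨{g}, Set.finite_singleton g⟩, P.ofIn g, f.args, ?_, P.ofIn_mem_chase rfl, ?_, rfl⟩
    · rintro _ rfl i j hij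
      exact hij.eq_of_const id (by simp)
    · rintro _ rfl
      exact hf
  · rintro _ ⟨r, hr, σ, hσ, rfl⟩
    have : ∀ A : r.canonicalInstance.facts, ∃ (β : Type) (J : Instance Sin β)
        (b : Fin ((Sin.sum P.Saux).arity A.1.rel) → β) (h : β → α), Forest J.facts ∧
        P.ofBody ⟨A.1.rel, b⟩ ∈ P.chase J ∧ (∀ f ∈ J.facts, f.map h ∈ I.facts) ∧
        ∀ i, h (b i) = σ (A.1.args i) := by
      rintro ⟨A, hA⟩
      obtain ⟨β, J, g, h, hJ, hg, hh, e⟩ := hσ A hA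
      obtain ⟨b, rfl, hb⟩ := P.exists_ofBody_of_map_eq e
      exact ⟨β, J, b, h, hJ, hg, hh, hb⟩
    choose β J b h hJ hb hh hhb using this
    have : Finite r.canonicalInstance.facts := r.canonicalInstance.finite
    -- The map back to `I` is `σ` on variables and `h` on the attached parts; the two agree on glued
    -- points.
    refine ⟨Glue b, Glue.inst b J, P.ofHead (r.head.map (Glue.var b)),
      Quot.lift (Sum.elim σ fun z => h z.1 z.2) ?_,
      Glue.forest (hP r hr).forest b J hJ, ?_, ?_, rfl⟩
    · rintro _ _ ⟨A, i⟩
      exact hhb A i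
    · refine P.head_mem_chase hr _ fun A hA => ?_
      have := P.map_mem_chase (J := Glue.inst b J) (h := Glue.mk b ⟨A, hA⟩)
        (fun f hf => Set.mem_iUnion.2 ⟨⟨A, hA⟩, f, hf, rfl⟩) (hb ⟨A, hA⟩)
      rw [P.ofBody_map] at this
      convert this using 2
      simp only [RelFact.map, RelFact.mk.injEq, heq_eq_eq, true_and]
      funext i
      exact (Glue.mk_point b ⟨A, hA⟩ i).symm
    · intro f hf
      obtain ⟨A, g, hg, rfl⟩ := Set.mem_iUnion.1 hf
      exact hh A g hg

theorem MSOQuery.DefinableIn.treeDetermined {S : Schema} {n : ℕ} {φ : MSOQuery S n}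
    (hφ : φ.DefinableIn DatalogProgram.TreeShaped) : φ.TreeDetermined := by
  obtain ⟨P, hP, R, rfl, hR⟩ := hφ
  intro α I a
  constructor
  · intro ha
    obtain ⟨β, J, g, h, hJ, hb, hh, e⟩ := hP.exists_forest ((hR α I a).2 ha)
    obtain ⟨b, rfl, hb'⟩ := RelFact.exists_of_map_eq e
    refine ⟨β, J, fun i => ⟨b i, P.args_mem_adom_of_mem_chase hb i⟩, hJ.acyclic,
      (hR β J _).1 hb, .ofMap h hh, fun i => Subtype.ext (hb' i)⟩
  · rintro ⟨β, J, b, -, hb, h, hba⟩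
    refine (hR α I a).1 ?_
    obtain rfl : (fun i => h.toFun (b i)) = a := funext hba
    exact P.map_hom_mem_chase h (f := ⟨Sum.inr (Sum.inl R), b⟩) ((hR β J b).2 hb)

/-! ### MSO types -/

/-- The atomic properties of an instance with a root and with sets indexed by `ι`. -/
inductive TpAtom (S : Schema) (ι : Type) : Type
  | rel (R : S.Rel) (x : Fin (S.arity R) → ι)
  | occurs (k : ι)
  | meet (k l : ι)
  | two (k : ι)
  | root (k : ι)

instance TpAtom.finite (S : Schema) (ι : Type) [Finite ι] : Finite (TpAtom S ι) := by
  have := S.finite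
  let e : ((Σ R : S.Rel, Fin (S.arity R) → ι) ⊕ ι ⊕ (ι × ι) ⊕ ι ⊕ ι) → TpAtom S ι :=
    Sum.elim (fun z => .rel z.1 z.2) (Sum.elim .occurs (Sum.elim (fun z => .meet z.1 z.2)
      (Sum.elim .two .root)))
  refine Finite.of_surjective e ?_
  rintro (⟨R, x⟩ | k | ⟨k, l⟩ | k | k)
  · exact ⟨.inl ⟨R, x⟩, rfl⟩
  · exact ⟨.inr (.inl k), rfl⟩
  · exact ⟨.inr (.inr (.inl (k, l))), rfl⟩
  · exact ⟨.inr (.inr (.inr (.inl k))), rfl⟩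
  · exact ⟨.inr (.inr (.inr (.inr k))), rfl⟩

/-- Satisfaction of an atomic property. -/
def TpAtom.Holds {S : Schema} {α ι : Type} (I : Instance S α) (a : α) (V : ι → Set α) :
    TpAtom S ι → Prop
  | rel R x => ∃ y : Fin (S.arity R) → α, ⟨R, y⟩ ∈ I.facts ∧ ∀ i, y i ∈ V (x i)
  | occurs k => ∃ x ∈ I.adom, x ∈ V k
  | meet k l => ∃ x, x ∈ V k ∧ x ∈ V l
  | two k => ∃ x ∈ V k, ∃ y ∈ V k, x ≠ y
  | root k => a ∈ V k

/-- The possible types of rank `q` of rooted instances with sets indexed by `ι`. -/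
def Tp (S : Schema) : ℕ → Type → Type
  | 0, ι => Set (TpAtom S ι)
  | q + 1, ι => Set (TpAtom S ι) × Set (Tp S q (Option ι))

instance Tp.finite (S : Schema) (q : ℕ) (ι : Type) [Finite ι] : Finite (Tp S q ι) := by
  induction q generalizing ι with
  | zero => exact inferInstanceAs (Finite (Set (TpAtom S ι)))
  | succ q ih =>
    have := ih (Option ι)
    exact inferInstanceAs (Finite (Set (TpAtom S ι) × Set (Tp S q (Option ι))))

/-- Adding one set to a family of sets. -/
def extend {α ι : Type} (V : ι → Set α) (A : Set α) : Option ι → Set α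
  | none => A
  | some k => V k

/-- The type of rank `q` of an instance with root `a` and sets `V`: its atomic properties, and the
types of smaller rank of its expansions by a set. -/
def tp {S : Schema} {α : Type} (I : Instance S α) (a : α) :
    (q : ℕ) → {ι : Type} → (ι → Set α) → Tp S q ι
  | 0, _, V => {A | A.Holds I a V}
  | q + 1, _, V => ({A | A.Holds I a V}, Set.range fun A => tp I a q (extend V A))

section Types

variable {S : Schema} {α β ι : Type} {I : Instance S α} {J : Instance S β} {a : α} {b : β}
  {V : ι → Set α} {W : ι → Set β} {q : ℕ}

theorem holds_iff_of_tp_eq (h : tp I a q V = tp J b q W) (A : TpAtom S ι) :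
    A.Holds I a V ↔ A.Holds J b W := by
  have h' : {A : TpAtom S ι | A.Holds I a V} = {A | A.Holds J b W} := by
    cases q with
    | zero => exact h
    | succ q => exact congrArg Prod.fst h
  exact Set.ext_iff.1 h' A

theorem exists_tp_extend_eq (h : tp I a (q + 1) V = tp J b (q + 1) W) (A : Set α) :
    ∃ B : Set β, tp I a q (extend V A) = tp J b q (extend W B) := by
  have h' : Set.range (fun A => tp I a q (extend V A)) = Set.range fun B => tp J b q (extend W B) :=
    congrArg Prod.snd h
  obtain ⟨B, hB⟩ : tp I a q (extend V A) ∈ Set.range fun B => tp J b q (extend W B) := by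
    rw [← h']
    exact ⟨A, rfl⟩
  exact ⟨B, hB.symm⟩

theorem tp_zero_eq (h0 : ∀ A : TpAtom S ι, A.Holds I a V ↔ A.Holds J b W) :
    tp I a 0 V = tp J b 0 W :=
  Set.ext h0

theorem tp_succ_eq (h0 : ∀ A : TpAtom S ι, A.Holds I a V ↔ A.Holds J b W)
    (h1 : ∀ A, ∃ B, tp I a q (extend V A) = tp J b q (extend W B))
    (h2 : ∀ B, ∃ A, tp I a q (extend V A) = tp J b q (extend W B)) :
    tp I a (q + 1) V = tp J b (q + 1) W := by
  refine Prod.ext (Set.ext h0) (Set.ext fun t => ⟨?_, ?_⟩)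
  · rintro ⟨A, rfl⟩
    obtain ⟨B, h⟩ := h1 A
    exact ⟨B, h.symm⟩
  · rintro ⟨B, rfl⟩
    obtain ⟨A, h⟩ := h2 B
    exact ⟨A, h⟩

/-- The quantifier rank of a formula. -/
def MSO.rank {S : Schema} : {n m : ℕ} → MSO S n m → ℕ
  | _, _, .rel _ _ => 0
  | _, _, .eq _ _ => 0
  | _, _, .mem _ _ => 0
  | _, _, .neg φ => φ.rank
  | _, _, .and φ ψ => max φ.rank ψ.rank
  | _, _, .or φ ψ => max φ.rank ψ.rank
  | _, _, .exElem φ => φ.rank + 1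
  | _, _, .allElem φ => φ.rank + 1
  | _, _, .exSet φ => φ.rank + 1
  | _, _, .allSet φ => φ.rank + 1

/-- The sets `V` interpret the variables of a formula: `e i` is the index of the singleton of
the `i`-th element variable, and `s j` that of the `j`-th set variable. -/
structure Interprets (I : Instance S α) (V : ι → Set α) {n m : ℕ} (e : Fin n → ι) (s : Fin m → ι)
    (v : Fin n → I.adom) (U : Fin m → Set I.adom) : Prop where
  elem : ∀ i, V (e i) = {(v i).1}
  set : ∀ j, U j = Subtype.val ⁻¹' V (s j)

theorem Interprets.extend_elem {n m : ℕ} {e : Fin n → ι} {s : Fin m → ι}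
    {v : Fin n → I.adom} {U : Fin m → Set I.adom} (h : Interprets I V e s v U) (x : I.adom) :
    Interprets I (extend V {x.1}) (Fin.snoc (α := fun _ => Option ι) (some ∘ e) none) (some ∘ s)
      (Fin.snoc (α := fun _ => I.adom) v x) U where
  elem i := by
    induction i using Fin.lastCases with
    | last => simp [extend]
    | cast i => simpa [extend] using h.elem i
  set := h.set

theorem Interprets.extend_set {n m : ℕ} {e : Fin n → ι} {s : Fin m → ι}
    {v : Fin n → I.adom} {U : Fin m → Set I.adom} (h : Interprets I V e s v U) (A : Set α) :
    Interprets I (extend V A) (some ∘ e) (Fin.snoc (α := fun _ => Option ι) (some ∘ s) none)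
      v (Fin.snoc (α := fun _ => Set I.adom) U (Subtype.val ⁻¹' A)) where
  elem := h.elem
  set j := by
    induction j using Fin.lastCases with
    | last => simp [extend]
    | cast j => simpa [extend] using h.set j

/-- An element of the active domain is matched by an element of the active domain. -/
theorem exists_elem_tp_eq (h : tp I a (q + 1) V = tp J b (q + 1) W) (x : I.adom) :
    ∃ y : J.adom, tp I a q (extend V {x.1}) = tp J b q (extend W {y.1}) := by
  obtain ⟨B, hB⟩ := exists_tp_extend_eq h {x.1}
  obtain ⟨y, hy, hyB⟩ := (holds_iff_of_tp_eq hB (.occurs none)).1 ⟨x.1, x.2, rfl⟩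
  -- `B` contains an element of the active domain and no two distinct values, so it is a singleton.
  have h2 := (holds_iff_of_tp_eq hB (.two none)).not.1 (by
    rintro ⟨z, rfl, w, rfl, h⟩
    exact h rfl)
  have : B = {y} := by
    refine Set.eq_singleton_iff_unique_mem.2 ⟨hyB, fun z hz => ?_⟩
    by_contra hne
    exact h2 ⟨z, hz, y, hyB, hne⟩
  subst this
  exact ⟨⟨y, hy⟩, hB⟩

/-- Types determine the formulas of bounded quantifier rank. -/
theorem MSO.realize_of_tp_eq {n m : ℕ} (φ : MSO S n m) {q : ℕ} (hq : φ.rank ≤ q)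
    {α β ι : Type} {I : Instance S α} {J : Instance S β} {a : α} {b : β}
    {V : ι → Set α} {W : ι → Set β} {e : Fin n → ι} {s : Fin m → ι}
    {v : Fin n → I.adom} {U : Fin m → Set I.adom} {v' : Fin n → J.adom} {U' : Fin m → Set J.adom}
    (hV : Interprets I V e s v U) (hW : Interprets J W e s v' U')
    (h : tp I a q V = tp J b q W) (hφ : φ.Realize I v U) : φ.Realize J v' U' := by
  induction φ generalizing q α β ι with
  | rel R x =>
    obtain ⟨y, hy, hyx⟩ := (holds_iff_of_tp_eq h (.rel R (e ∘ x))).1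
      ⟨_, hφ, fun i => by simp [hV.elem]⟩
    simp only [Function.comp, hW.elem, Set.mem_singleton_iff] at hyx
    obtain rfl : y = _ := funext hyx
    exact hy
  | eq x y =>
    obtain ⟨z, hz, hz'⟩ := (holds_iff_of_tp_eq h (.meet (e x) (e y))).1
      ⟨(v x).1, by simp [hV.elem], by
        have : v x = v y := hφ
        simp [hV.elem, this]⟩
    simp only [hW.elem, Set.mem_singleton_iff] at hz hz'
    exact Subtype.ext (hz.symm.trans hz')
  | mem x X =>
    obtain ⟨z, hz, hz'⟩ := (holds_iff_of_tp_eq h (.meet (e x) (s X))).1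
      ⟨(v x).1, by simp [hV.elem], by
        have : v x ∈ U X := hφ
        simpa [hV.set] using this⟩
    simp only [hW.elem, Set.mem_singleton_iff] at hz
    subst hz
    change v' x ∈ U' X
    rw [hW.set]
    exact hz'
  | neg φ ih => exact fun h' => hφ (ih hq hW hV h.symm h')
  | and φ ψ ih ih' =>
    have := max_le_iff.1 hq
    exact ⟨ih this.1 hV hW h hφ.1, ih' this.2 hV hW h hφ.2⟩
  | or φ ψ ih ih' =>
    have := max_le_iff.1 hq
    exact hφ.imp (ih this.1 hV hW h) (ih' this.2 hV hW h)
  | exElem φ ih =>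
    obtain ⟨q, rfl⟩ := Nat.exists_eq_add_of_lt (Nat.lt_of_succ_le hq)
    obtain ⟨x, hx⟩ := hφ
    obtain ⟨y, hy⟩ := exists_elem_tp_eq h x
    exact ⟨y, ih (Nat.le_add_right _ _) (hV.extend_elem x) (hW.extend_elem y) hy hx⟩
  | allElem φ ih =>
    obtain ⟨q, rfl⟩ := Nat.exists_eq_add_of_lt (Nat.lt_of_succ_le hq)
    intro y
    obtain ⟨x, hx⟩ := exists_elem_tp_eq h.symm y
    exact ih (Nat.le_add_right _ _) (hV.extend_elem x) (hW.extend_elem y) hx.symm (hφ x)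
  | exSet φ ih =>
    obtain ⟨q, rfl⟩ := Nat.exists_eq_add_of_lt (Nat.lt_of_succ_le hq)
    obtain ⟨A, hA⟩ := hφ
    -- Types quantify over subsets of `α`, formulas over subsets of the active domain; taking image
    -- and then preimage recovers `A`.
    obtain ⟨B, hB⟩ := exists_tp_extend_eq h (Subtype.val '' A)
    have hVA := hV.extend_set (Subtype.val '' A)
    rw [Set.preimage_image_eq _ Subtype.val_injective] at hVA
    exact ⟨_, ih (Nat.le_add_right _ _) hVA (hW.extend_set B) hB hA⟩
  | allSet φ ih =>
    obtain ⟨q, rfl⟩ := Nat.exists_eq_add_of_lt (Nat.lt_of_succ_le hq)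
    intro B
    obtain ⟨A, hA⟩ := exists_tp_extend_eq h.symm (Subtype.val '' B)
    have hWB := hW.extend_set (Subtype.val '' B)
    rw [Set.preimage_image_eq _ Subtype.val_injective] at hWB
    exact ih (Nat.le_add_right _ _) (hV.extend_set A) hWB hA.symm (hφ _)

/-- Replacing some of the sets by the empty set preserves equality of types. -/
theorem tp_mask_eq {ι : Type} {V : ι → Set α} {W : ι → Set β} (h : tp I a q V = tp J b q W)
    (D : ι → Prop) :
    tp I a q (fun k => {x | D k ∧ x ∈ V k}) = tp J b q (fun k => {x | D k ∧ x ∈ W k}) := by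
  have key : ∀ (q : ℕ) {ι : Type} {V : ι → Set α} {W : ι → Set β},
      tp I a q V = tp J b q W → ∀ (D : ι → Prop) (A : TpAtom S ι),
      A.Holds I a (fun k => {x | D k ∧ x ∈ V k}) ↔ A.Holds J b (fun k => {x | D k ∧ x ∈ W k}) := by
    intro q ι V W h D A
    have hA := holds_iff_of_tp_eq h A
    cases A with
    | rel R x =>
      by_cases hD : ∀ i, D (x i)
      · simpa [TpAtom.Holds, hD] using hA
      · push Not at hD
        obtain ⟨i, hi⟩ := hD
        exact ⟨fun ⟨_, _, h⟩ => (hi (h i).1).elim, fun ⟨_, _, h⟩ => (hi (h i).1).elim⟩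
    | occurs k => by_cases hD : D k <;> simp [TpAtom.Holds, hD] at hA ⊢; exact hA
    | meet k l =>
      by_cases hD : D k <;> by_cases hD' : D l <;> simp [TpAtom.Holds, hD, hD'] at hA ⊢; exact hA
    | two k => by_cases hD : D k <;> simp [TpAtom.Holds, hD] at hA ⊢; exact hA
    | root k => by_cases hD : D k <;> simp [TpAtom.Holds, hD] at hA ⊢; exact hA
  -- A newly quantified set is never masked, so the mask extends by `True`.
  have hext : ∀ {α ι : Type} (V : ι → Set α) (D : ι → Prop) (A : Set α),
      extend (fun k => {x | D k ∧ x ∈ V k}) A =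
        fun k : Option ι => {x | (k.elim True D) ∧ x ∈ extend V A k} := by
    intro α ι V D A
    funext k
    cases k <;> simp [extend]
  induction q generalizing ι with
  | zero => exact tp_zero_eq (key 0 h D)
  | succ q ih =>
    refine tp_succ_eq (key _ h D) (fun A => ?_) (fun B => ?_)
    · obtain ⟨B, hB⟩ := exists_tp_extend_eq h A
      refine ⟨B, ?_⟩
      rw [hext, hext]
      exact ih hB _
    · obtain ⟨A, hA⟩ := exists_tp_extend_eq h.symm B
      refine ⟨A, ?_⟩
      rw [hext, hext]
      exact ih hA.symm _

end Types

/-! ### Joining instances -/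

section Join

variable {S : Schema} {ι : Type} {α β : ι → Type}

/-- The disjoint union of instances, with an optional additional fact on their roots. -/
def Instance.join [Finite ι] (A : Option (RelFact S ι)) (I : ∀ i, Instance S (α i))
    (a : ∀ i, α i) : Instance S (Σ i, α i) where
  facts := (⋃ i, RelFact.map (Sigma.mk i) '' (I i).facts) ∪
    {f | ∃ g ∈ A, f = g.map fun i => ⟨i, a i⟩}
  finite := by
    refine (Set.finite_iUnion fun i => (I i).finite.image _).union ?_
    refine (A.toList.finite_toSet.image (RelFact.map fun i => (⟨i, a i⟩ : Σ i, α i))).subset ?_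
    rintro _ ⟨g, hg, rfl⟩
    exact ⟨g, by simpa using hg, rfl⟩

variable [Finite ι] {A : Option (RelFact S ι)} {I : ∀ i, Instance S (α i)} {a : ∀ i, α i}
  {J : ∀ i, Instance S (β i)} {b : ∀ i, β i}

theorem Instance.mem_join_iff {f : RelFact S (Σ i, α i)} : f ∈ (Instance.join A I a).facts ↔
    (∃ i, ∃ g ∈ (I i).facts, g.map (Sigma.mk i) = f) ∨
      ∃ g ∈ A, f = g.map fun i => ⟨i, a i⟩ := by
  simp [Instance.join]

theorem Instance.mk_mem_join_iff {R : S.Rel} {y : Fin (S.arity R) → Σ i, α i} :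
    (⟨R, y⟩ : RelFact S _) ∈ (Instance.join A I a).facts ↔
    (∃ i, ∃ z : Fin (S.arity R) → α i, ⟨R, z⟩ ∈ (I i).facts ∧ ∀ k, y k = ⟨i, z k⟩) ∨
      ∃ g : Fin (S.arity R) → ι, ⟨R, g⟩ ∈ A ∧ ∀ k, y k = ⟨g k, a (g k)⟩ := by
  rw [Instance.mem_join_iff]
  constructor
  · rintro (⟨i, g, hg, e⟩ | ⟨g, hg, e⟩)
    · obtain ⟨z, rfl, hz⟩ := RelFact.exists_of_map_eq e
      exact Or.inl ⟨i, z, hg, fun k => (hz k).symm⟩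
    · obtain ⟨z, rfl, hz⟩ := RelFact.exists_of_map_eq e.symm
      exact Or.inr ⟨z, hg, fun k => (hz k).symm⟩
  · rintro (⟨i, z, hz, e⟩ | ⟨g, hg, e⟩)
    · obtain rfl : y = _ := funext e
      exact Or.inl ⟨i, _, hz, rfl⟩
    · obtain rfl : y = _ := funext e
      exact Or.inr ⟨_, hg, rfl⟩

theorem Instance.mem_adom_join_iff {i : ι} {x : α i} :
    (⟨i, x⟩ : Σ i, α i) ∈ (Instance.join A I a).adom ↔
    x ∈ (I i).adom ∨ (x = a i ∧ ∃ g ∈ A, ∃ k, g.args k = i) := by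
  constructor
  · rintro ⟨f, hf, k, hk⟩
    rcases Instance.mem_join_iff.1 hf with ⟨j, g, hg, rfl⟩ | ⟨g, hg, rfl⟩
    · obtain ⟨rfl, h⟩ := Sigma.mk.inj hk
      exact Or.inl ⟨g, hg, k, eq_of_heq h⟩
    · obtain ⟨rfl, h⟩ := Sigma.mk.inj hk
      exact Or.inr ⟨(eq_of_heq h).symm, g, hg, k, rfl⟩
  · rintro (⟨f, hf, k, rfl⟩ | ⟨rfl, g, hg, k, rfl⟩)
    · exact ⟨_, Instance.mem_join_iff.2 (Or.inl ⟨i, f, hf, rfl⟩), k, rfl⟩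
    · exact ⟨_, Instance.mem_join_iff.2 (Or.inr ⟨g, hg, rfl⟩), k, rfl⟩

/-- Joining forests at their roots by a fact without repeated arguments yields a forest. -/
theorem Forest.join (hA : ∀ g ∈ A, Function.Injective g.args) (hI : ∀ i, Forest (I i).facts) :
    Forest (Instance.join A I a).facts := by
  classical
  intro f hf k l hkl
  rcases Instance.mem_join_iff.1 hf with ⟨i, g, hg, rfl⟩ | ⟨g, hg, rfl⟩
  -- All other parts collapse onto the root of part `i`. The joining fact then becomes constant,
  -- since it touches only roots.
  · let r : (Σ i, α i) → α i := fun z => if h : z.1 = i then h ▸ z.2 else a i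
    have hr : ∀ x, r ⟨i, x⟩ = x := fun x => by simp [r]
    have hr' : ∀ j x, j ≠ i → r ⟨j, x⟩ = a i := fun j x h => by simp [r, h]
    have hra : ∀ j, r ⟨j, a j⟩ = a i := by
      intro j
      by_cases h : j = i
      · subst h
        exact hr _
      · exact hr' _ _ h
    refine hI i g hg k l ?_
    have := hkl.map (G := (I i).facts \ {g}) r ?_
    · simpa [RelFact.map, hr] using this
    · rintro f' ⟨hf', hne⟩ m m'
      rcases Instance.mem_join_iff.1 hf' with ⟨j, g', hg', rfl⟩ | ⟨g', hg', rfl⟩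
      · by_cases h : j = i
        · subst h
          have hgg : g' ≠ g := by
            rintro rfl
            exact hne rfl
          simp only [RelFact.map, hr]
          exact Conn.of_mem (F := (I j).facts \ {g}) ⟨hg', hgg⟩ m m'
        · simp only [RelFact.map, hr' j _ h]
          exact Conn.refl _ _
      · simp only [RelFact.map, hra]
        exact Conn.refl _ _
  · refine hA g hg ?_
    -- Without the joining fact, every fact lies in a single part.
    refine hkl.eq_of_const Sigma.fst ?_
    rintro f' ⟨hf', hne⟩ m m'
    rcases Instance.mem_join_iff.1 hf' with ⟨j, g', hg', rfl⟩ | ⟨g', hg', rfl⟩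
    · rfl
    · have : g' = g := Option.mem_unique hg' hg
      subst this
      exact (hne rfl).elim

/-- The atomic properties of a join in terms of those of its parts. -/
theorem TpAtom.holds_join_iff {κ : Type} {i₀ : ι} {V : κ → Set (Σ i, α i)} (t : TpAtom S κ) :
    t.Holds (Instance.join A I a) ⟨i₀, a i₀⟩ V ↔
      match t with
      | rel R x => (∃ i, (rel R x).Holds (I i) (a i) fun k => Sigma.mk i ⁻¹' V k) ∨
          ∃ g : Fin (S.arity R) → ι, ⟨R, g⟩ ∈ A ∧
            ∀ l, (root (S := S) (x l)).Holds (I (g l)) (a (g l)) fun k => Sigma.mk (g l) ⁻¹' V k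
      | occurs k => ∃ i, (occurs (S := S) k).Holds (I i) (a i) (fun k => Sigma.mk i ⁻¹' V k) ∨
          ((∃ g ∈ A, ∃ l, g.args l = i) ∧
            (root (S := S) k).Holds (I i) (a i) fun k => Sigma.mk i ⁻¹' V k)
      | meet k l => ∃ i, (meet (S := S) k l).Holds (I i) (a i) fun k => Sigma.mk i ⁻¹' V k
      | two k => (∃ i, (two (S := S) k).Holds (I i) (a i) fun k => Sigma.mk i ⁻¹' V k) ∨
          ∃ i j, i ≠ j ∧ ((meet (S := S) k k).Holds (I i) (a i) fun k => Sigma.mk i ⁻¹' V k) ∧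
            ((meet (S := S) k k).Holds (I j) (a j) fun k => Sigma.mk j ⁻¹' V k)
      | root k => (root (S := S) k).Holds (I i₀) (a i₀) fun k => Sigma.mk i₀ ⁻¹' V k := by
  cases t with
  | rel R x =>
    simp only [TpAtom.Holds, Instance.mk_mem_join_iff, Set.mem_preimage]
    constructor
    · rintro ⟨y, ⟨i, z, hz, e⟩ | ⟨g, hg, e⟩, hy⟩
      · exact Or.inl ⟨i, z, hz, fun k => e k ▸ hy k⟩
      · exact Or.inr ⟨g, hg, fun k => e k ▸ hy k⟩
    · rintro (⟨i, z, hz, hV⟩ | ⟨g, hg, hV⟩)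
      · exact ⟨_, Or.inl ⟨i, z, hz, fun _ => rfl⟩, hV⟩
      · exact ⟨_, Or.inr ⟨g, hg, fun _ => rfl⟩, hV⟩
  | occurs k =>
    simp only [TpAtom.Holds, Set.mem_preimage]
    constructor
    · rintro ⟨⟨i, x⟩, hx, hV⟩
      rcases Instance.mem_adom_join_iff.1 hx with h | ⟨rfl, h⟩
      · exact ⟨i, Or.inl ⟨x, h, hV⟩⟩
      · exact ⟨i, Or.inr ⟨h, hV⟩⟩
    · rintro ⟨i, ⟨x, hx, hV⟩ | ⟨h, hV⟩⟩
      · exact ⟨⟨i, x⟩, Instance.mem_adom_join_iff.2 (Or.inl hx), hV⟩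
      · exact ⟨⟨i, a i⟩, Instance.mem_adom_join_iff.2 (Or.inr ⟨rfl, h⟩), hV⟩
  | meet k l => simp [TpAtom.Holds, Sigma.exists]
  | two k =>
    simp only [TpAtom.Holds, Set.mem_preimage, and_self]
    constructor
    · rintro ⟨⟨i, x⟩, hx, ⟨j, y⟩, hy, hne⟩
      by_cases h : i = j
      · subst h
        exact Or.inl ⟨i, x, hx, y, hy, fun h => hne (h ▸ rfl)⟩
      · exact Or.inr ⟨i, j, h, ⟨x, hx⟩, ⟨y, hy⟩⟩
    · rintro (⟨i, x, hx, y, hy, hne⟩ | ⟨i, j, hne, ⟨x, hx⟩, ⟨y, hy⟩⟩)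
      · exact ⟨_, hx, _, hy, fun h => hne (eq_of_heq (Sigma.mk.inj h).2)⟩
      · exact ⟨_, hx, _, hy, fun h => hne (Sigma.mk.inj h).1⟩
  | root k => rfl

/-- The type of a join is determined by the types of its parts. -/
theorem tp_join_eq {κ : Type} {q : ℕ} {V : κ → Set (Σ i, α i)} {W : κ → Set (Σ i, β i)} (i₀ : ι)
    (h : ∀ i, tp (I i) (a i) q (fun k => Sigma.mk i ⁻¹' V k) =
      tp (J i) (b i) q (fun k => Sigma.mk i ⁻¹' W k)) :
    tp (Instance.join A I a) ⟨i₀, a i₀⟩ q V = tp (Instance.join A J b) ⟨i₀, b i₀⟩ q W := by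
  have key : ∀ (q : ℕ) {κ : Type} {V : κ → Set (Σ i, α i)} {W : κ → Set (Σ i, β i)},
      (∀ i, tp (I i) (a i) q (fun k => Sigma.mk i ⁻¹' V k) =
        tp (J i) (b i) q (fun k => Sigma.mk i ⁻¹' W k)) → ∀ t : TpAtom S κ,
      t.Holds (Instance.join A I a) ⟨i₀, a i₀⟩ V ↔ t.Holds (Instance.join A J b) ⟨i₀, b i₀⟩ W := by
    intro q κ V W h t
    have ht := fun i => holds_iff_of_tp_eq (h i)
    rw [TpAtom.holds_join_iff, TpAtom.holds_join_iff]
    cases t <;> simp only [ht]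
  have hext : ∀ {α : ι → Type} {κ : Type} (V : κ → Set (Σ i, α i)) (B : Set (Σ i, α i)) (i : ι),
      (fun k => Sigma.mk i ⁻¹' extend V B k) =
        extend (fun k => Sigma.mk i ⁻¹' V k) (Sigma.mk i ⁻¹' B) := by
    intro α κ V B i
    funext k
    cases k <;> rfl
  have hpre : ∀ {α : ι → Type} (B : ∀ i, Set (α i)) (i : ι),
      Sigma.mk i ⁻¹' {z : Σ i, α i | z.2 ∈ B z.1} = B i := fun B i => rfl
  induction q generalizing κ with
  | zero => exact tp_zero_eq (key 0 h)
  | succ q ih =>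
    refine tp_succ_eq (key _ h) (fun B => ?_) (fun B => ?_)
    -- A subset of a disjoint union is a family of subsets of the parts, so the matching set is
    -- chosen in each part separately.
    · choose C hC using fun i => exists_tp_extend_eq (h i) (Sigma.mk i ⁻¹' B)
      refine ⟨{z | z.2 ∈ C z.1}, ih fun i => ?_⟩
      rw [hext, hext, hpre]
      exact hC i
    · choose C hC using fun i => exists_tp_extend_eq (h i).symm (Sigma.mk i ⁻¹' B)
      refine ⟨{z | z.2 ∈ C z.1}, ih fun i => ?_⟩
      rw [hext, hext, hpre]
      exact (hC i).symm

end Join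

/-! ### Isomorphism invariance -/

theorem MSO.realize_equiv_iff {S : Schema} {α β : Type} {I : Instance S α} {J : Instance S β}
    (e : I.adom ≃ J.adom)
    (he : ∀ (R : S.Rel) (y : Fin (S.arity R) → I.adom),
      (⟨R, fun i => (y i).1⟩ : RelFact S α) ∈ I.facts ↔
        (⟨R, fun i => (e (y i)).1⟩ : RelFact S β) ∈ J.facts)
    {n m : ℕ} (φ : MSO S n m) (v : Fin n → I.adom) (U : Fin m → Set I.adom) :
    φ.Realize I v U ↔ φ.Realize J (fun i => e (v i)) (fun j => e.symm ⁻¹' U j) := by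
  have hsn : ∀ {n : ℕ} (v : Fin n → I.adom) (x : I.adom),
      (fun i => e (Fin.snoc (α := fun _ => I.adom) v x i)) =
        Fin.snoc (α := fun _ => J.adom) (fun i => e (v i)) (e x) := by
    intro n v x
    funext i
    induction i using Fin.lastCases <;> simp
  have hss : ∀ {m : ℕ} (U : Fin m → Set I.adom) (A : Set I.adom),
      (fun j => e.symm ⁻¹' Fin.snoc (α := fun _ => Set I.adom) U A j) =
        Fin.snoc (α := fun _ => Set J.adom) (fun j => e.symm ⁻¹' U j) (e.symm ⁻¹' A) := by
    intro m U A
    funext i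
    induction i using Fin.lastCases <;> simp
  have hpre : Function.Surjective fun A : Set I.adom => e.symm ⁻¹' A := fun B =>
    ⟨e ⁻¹' B, by ext; simp⟩
  induction φ with
  | rel R x => exact he R _
  | eq x y => exact e.injective.eq_iff.symm
  | mem x X => simp [MSO.Realize]
  | neg φ ih => exact (ih v U).not
  | and φ ψ ih ih' => exact and_congr (ih v U) (ih' v U)
  | or φ ψ ih ih' => exact or_congr (ih v U) (ih' v U)
  | exElem φ ih => simp only [MSO.Realize, ih, hsn, e.surjective.exists]
  | allElem φ ih => simp only [MSO.Realize, ih, hsn, e.surjective.forall]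
  | exSet φ ih => simp only [MSO.Realize, ih, hss, hpre.exists]
  | allSet φ ih => simp only [MSO.Realize, ih, hss, hpre.forall]

/-- A map that is injective on the active domain and bijective on facts preserves queries. -/
theorem MSOQuery.holds_iff_of_image_eq {S : Schema} {α β : Type} {I : Instance S α}
    {J : Instance S β} {h : α → β} (hinj : Set.InjOn h I.adom)
    (himg : RelFact.map h '' I.facts = J.facts) {n : ℕ} (φ : MSOQuery S n) {v : Fin n → I.adom}
    {w : Fin n → J.adom} (hvw : ∀ i, h (v i).1 = (w i).1) : φ.Holds I v ↔ φ.Holds J w := by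
  have hmem : ∀ f ∈ I.facts, f.map h ∈ J.facts := fun f hf => himg ▸ ⟨f, hf, rfl⟩
  let k : I.Hom J := .ofMap h hmem
  have hk : Function.Bijective k.toFun := by
    constructor
    · intro x y hxy
      exact Subtype.ext (hinj x.2 y.2 (congrArg Subtype.val hxy))
    · rintro ⟨_, f, hf, i, rfl⟩
      rw [← himg] at hf
      obtain ⟨g, hg, rfl⟩ := hf
      exact ⟨⟨g.args i, g, hg, i, rfl⟩, rfl⟩
  have := MSO.realize_equiv_iff (Equiv.ofBijective _ hk) ?_ φ v Fin.elim0
  · refine this.trans (iff_of_eq ?_)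
    change MSO.Realize J φ _ _ = MSO.Realize J φ w Fin.elim0
    congr 1
    · funext i
      exact Subtype.ext (hvw i)
    · funext j
      exact j.elim0
  · intro R y
    refine ⟨fun hf => hmem _ hf, fun hf => ?_⟩
    rw [← himg] at hf
    obtain ⟨g, hg, e⟩ := hf
    obtain ⟨z, rfl, hz⟩ := RelFact.exists_of_map_eq e
    obtain rfl : z = fun i => (y i).1 := funext fun i =>
      hinj ⟨_, hg, i, rfl⟩ (y i).2 (hz i)
    exact hg

/-! ### Types of pointed instances -/

section Pointed

variable {S : Schema} {n : ℕ}

/-- The type of rank `q` of an instance with points `p`, the first of which is the root. -/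
def ptp (q : ℕ) {α : Type} (I : Instance S α) (p : Fin (n + 1) → α) : Tp S q (Fin (n + 1)) :=
  tp I (p 0) q fun k => {p k}

/-- Points of a disjoint union: the `k`-th point is taken from the part `c k`. -/
def joinPoints {ι : Type} {α : ι → Type} (c : Fin (n + 1) → ι) (p : ∀ i, Fin (n + 1) → α i)
    (k : Fin (n + 1)) : Σ i, α i :=
  ⟨c k, p (c k) k⟩

/-- The `k`-th singleton of the join restricts to the `k`-th singleton of part `c k` and to the
empty set elsewhere. The types of the parts therefore have to be masked before they are composed. -/
theorem ptp_join_eq {ι : Type} [Finite ι] {α β : ι → Type} {q : ℕ} (A : Option (RelFact S ι))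
    (c : Fin (n + 1) → ι) {I : ∀ i, Instance S (α i)} {J : ∀ i, Instance S (β i)}
    {p : ∀ i, Fin (n + 1) → α i} {p' : ∀ i, Fin (n + 1) → β i}
    (h : ∀ i, ptp q (I i) (p i) = ptp q (J i) (p' i)) :
    ptp q (Instance.join A I fun i => p i 0) (joinPoints c p) =
      ptp q (Instance.join A J fun i => p' i 0) (joinPoints c p') := by
  have hpre : ∀ {α : ι → Type} (p : ∀ i, Fin (n + 1) → α i) (i : ι),
      (fun k => Sigma.mk i ⁻¹' {joinPoints c p k}) =
        fun k => {x | c k = i ∧ x ∈ ({p i k} : Set (α i))} := by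
    intro α p i
    funext k
    ext x
    simp only [joinPoints, Set.mem_preimage, Set.mem_singleton_iff, Set.mem_ofPred_eq]
    constructor
    · intro h
      obtain ⟨rfl, h⟩ := Sigma.mk.inj h
      exact ⟨rfl, eq_of_heq h⟩
    · rintro ⟨rfl, rfl⟩
      rfl
  refine tp_join_eq (I := I) (J := J) (a := fun i => p i 0) (b := fun i => p' i 0) (c 0) fun i => ?_
  rw [hpre, hpre]
  exact tp_mask_eq (h i) _

/-- Types of sufficient rank determine whether a query holds at the points after the root. -/
theorem MSOQuery.holds_of_ptp_eq (φ : MSOQuery S n) {q : ℕ} (hq : φ.rank ≤ q) {α β : Type}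
    {I : Instance S α} {J : Instance S β} {a : Fin (n + 1) → α} {b : Fin (n + 1) → β}
    (h : ptp q I a = ptp q J b) (ha : ∀ k : Fin n, a k.succ ∈ I.adom)
    (hφ : φ.Holds I fun k => ⟨a k.succ, ha k⟩) :
    ∃ hb : ∀ k : Fin n, b k.succ ∈ J.adom, φ.Holds J fun k => ⟨b k.succ, hb k⟩ := by
  have hb : ∀ k : Fin n, b k.succ ∈ J.adom := by
    intro k
    obtain ⟨x, hx, hxk⟩ := (holds_iff_of_tp_eq h (.occurs k.succ)).1 ⟨_, ha k, rfl⟩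
    rw [Set.mem_singleton_iff] at hxk
    exact hxk ▸ hx
  exact ⟨hb, φ.realize_of_tp_eq hq (e := Fin.succ) (s := Fin.elim0)
    ⟨fun _ => rfl, fun j => j.elim0⟩ ⟨fun _ => rfl, fun j => j.elim0⟩ h hφ⟩

end Pointed

/-! ### The program computing types -/

instance RelFact.finite (S : Schema) (α : Type) [Finite α] : Finite (RelFact S α) := by
  have := S.finite
  exact Finite.of_surjective (fun z : Σ R : S.Rel, Fin (S.arity R) → α => ⟨z.1, z.2⟩)
    fun f => ⟨⟨f.rel, f.args⟩, rfl⟩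

instance Instance.finite_of_finite (S : Schema) (α : Type) [Finite α] : Finite (Instance S α) :=
  Finite.of_injective Instance.facts fun I J h => by
    cases I
    cases J
    congr

/-- A single `n`-ary output relation. -/
def outSchema (n : ℕ) : Schema := ⟨Unit, inferInstance, fun _ => n⟩

/-- One relation for each type; its arguments are the points. -/
def typeSchema (S : Schema) (q n : ℕ) : Schema :=
  ⟨Tp S q (Fin (n + 1)), inferInstance, fun _ => n + 1⟩

section Program

variable {S : Schema} {n : ℕ}

/-- An input atom of a rule body. -/
def inAtom (S T : Schema) {X : Type} (f : RelFact S X) : RelFact (S.sum T) X :=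
  ⟨Sum.inl f.rel, f.args⟩

/-- An auxiliary atom stating that the points `p` have type `t`. -/
def typeAtom (S' : Schema) {q : ℕ} {X : Type} (t : Tp S q (Fin (n + 1))) (p : Fin (n + 1) → X) :
    RelFact (S'.sum (typeSchema S q n)) X := ⟨Sum.inr t, p⟩

/-- The type of a single point without facts. -/
def pointType (S : Schema) (q n : ℕ) : Tp S q (Fin (n + 1)) :=
  ptp q (⟨∅, Set.finite_empty⟩ : Instance S Unit) fun _ => ()

/-- Each element of the active domain is a single point. -/
def pointRule (q n : ℕ) (R : S.Rel) (i : Fin (S.arity R)) :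
    DatalogRule S (outSchema n) (typeSchema S q n) where
  Var := Fin (S.arity R)
  head := typeAtom _ (pointType S q n) fun _ => i
  body := [inAtom S _ ⟨R, id⟩]
  safe x := ⟨_, List.mem_singleton_self _, x, rfl⟩

/-- The body of `joinRule`. -/
def joinBody {q N : ℕ} (A : Option (RelFact S (Fin N))) (t : Fin N → Tp S q (Fin (n + 1))) :
    List (RelFact (S.sum (typeSchema S q n)) (Fin N × Fin (n + 1))) :=
  A.toList.map (fun f => inAtom S _ (f.map fun i => (i, 0))) ++
    List.ofFn fun i => typeAtom S (t i) fun k => (i, k)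

/-- Parts of types `t i` are joined to an instance of type `t'`. -/
def joinRule {q N : ℕ} (A : Option (RelFact S (Fin N))) (c : Fin (n + 1) → Fin N)
    (t : Fin N → Tp S q (Fin (n + 1))) (t' : Tp S q (Fin (n + 1))) :
    DatalogRule S (outSchema n) (typeSchema S q n) where
  Var := Fin N × Fin (n + 1)
  head := typeAtom _ t' fun k => (c k, k)
  body := joinBody A t
  safe x := ⟨typeAtom S (t x.1) fun k => (x.1, k),
    List.mem_append_right _ (List.mem_ofFn.2 ⟨x.1, rfl⟩), x.2, rfl⟩

/-- The points after the root of an instance of type `t` are output. -/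
def outRule {q : ℕ} (t : Tp S q (Fin (n + 1))) :
    DatalogRule S (outSchema n) (typeSchema S q n) where
  Var := Fin (n + 1)
  head := ⟨Sum.inl (), Fin.succ⟩
  body := [typeAtom S t id]
  safe x := ⟨_, List.mem_singleton_self _, x, rfl⟩

/-- The rule for an instance all of whose facts are nullary. -/
noncomputable def nullaryRule (q : ℕ) (J : Instance S Empty) (a : Fin n → Empty) :
    DatalogRule S (outSchema n) (typeSchema S q n) where
  Var := Empty
  head := ⟨Sum.inl (), a⟩
  body := J.finite.toFinset.toList.map (inAtom S _)
  safe x := x.elim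

/-- Types of pointed instances in which the query holds. -/
def Accepting (φ : MSOQuery S n) {q : ℕ} (t : Tp S q (Fin (n + 1))) : Prop :=
  ∃ (β : Type) (J : Instance S β) (b : Fin (n + 1) → β) (hb : ∀ k : Fin n, b k.succ ∈ J.adom),
    ptp q J b = t ∧ φ.Holds J fun k => ⟨b k.succ, hb k⟩

/-- Some join of instances of types `t i` has type `u`. -/
def Composes {q N : ℕ} (A : Option (RelFact S (Fin N))) (c : Fin (n + 1) → Fin N)
    (t : Fin N → Tp S q (Fin (n + 1))) (u : Tp S q (Fin (n + 1))) : Prop :=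
  ∃ (α : Fin N → Type) (I : ∀ i, Instance S (α i)) (p : ∀ i, Fin (n + 1) → α i),
    (∀ i, ptp q (I i) (p i) = t i) ∧
      ptp q (Instance.join A I fun i => p i 0) (joinPoints c p) = u

/-- The rules of the program for `φ`. -/
inductive TypeRule (φ : MSOQuery S n) (q N : ℕ) :
    DatalogRule S (outSchema n) (typeSchema S q n) → Prop
  | point (R : S.Rel) (i : Fin (S.arity R)) : TypeRule φ q N (pointRule q n R i)
  | join (A : Option (RelFact S (Fin N))) (c : Fin (n + 1) → Fin N)
      (t : Fin N → Tp S q (Fin (n + 1))) (t' : Tp S q (Fin (n + 1)))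
      (hA : ∀ f ∈ A, Function.Injective f.args) (ht : Composes A c t t') :
      TypeRule φ q N (joinRule A c t t')
  | out (t : Tp S q (Fin (n + 1))) (ht : Accepting φ t) : TypeRule φ q N (outRule t)
  | nullary (J : Instance S Empty) (a : Fin n → J.adom) (ha : φ.Holds J a) :
      TypeRule φ q N (nullaryRule q J fun k => (a k).1)

/-- The program for `φ` with types of rank `q` and joins of `N` parts. -/
def typeProgram (φ : MSOQuery S n) (q N : ℕ) : DatalogProgram S where
  Sout := outSchema n
  Saux := typeSchema S q n
  rules := {r | TypeRule φ q N r}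
  finite := by
    have := S.finite
    refine Set.Finite.subset
      ((((Set.finite_range fun z : Σ R : S.Rel, Fin (S.arity R) => pointRule q n z.1 z.2).union
        (Set.finite_range fun z : Option (RelFact S (Fin N)) × (Fin (n + 1) → Fin N) ×
          (Fin N → Tp S q (Fin (n + 1))) × Tp S q (Fin (n + 1)) =>
          joinRule z.1 z.2.1 z.2.2.1 z.2.2.2)).union
        (Set.finite_range fun t : Tp S q (Fin (n + 1)) => outRule t)).union
        (Set.finite_range fun z : Instance S Empty × (Fin n → Empty) => nullaryRule q z.1 z.2)) ?_
    rintro _ (⟨R, i⟩ | ⟨A, c, t, t', -, -⟩ | ⟨t, -⟩ | ⟨J, a, -⟩)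
    · exact Or.inl (Or.inl (Or.inl ⟨⟨R, i⟩, rfl⟩))
    · exact Or.inl (Or.inl (Or.inr ⟨(A, c, t, t'), rfl⟩))
    · exact Or.inl (Or.inr ⟨t, rfl⟩)
    · exact Or.inr ⟨(J, fun k => (a k).1), rfl⟩

/-! ### The program is tree-shaped and almost monadic -/

theorem mem_joinBody {q N : ℕ} {A : Option (RelFact S (Fin N))}
    {t : Fin N → Tp S q (Fin (n + 1))}
    {f : RelFact (S.sum (typeSchema S q n)) (Fin N × Fin (n + 1))} :
    f ∈ joinBody A t ↔ (∃ g ∈ A, f = inAtom S _ (g.map fun i => (i, 0))) ∨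
      ∃ i, f = typeAtom S (t i) fun k => (i, k) := by
  simp [joinBody, List.mem_ofFn, eq_comm]

theorem forest_singleton {T : Schema} {X : Type} {f : RelFact T X}
    (hf : Function.Injective f.args) : Forest ({f} : Set (RelFact T X)) := by
  rintro _ rfl i j hij
  exact hf (hij.eq_of_const id (by simp))

theorem typeAtom_ne_of_ne {q N : ℕ} {t : Fin N → Tp S q (Fin (n + 1))} {i j : Fin N}
    (h : typeAtom S (t i) (fun k => (i, k)) ≠ typeAtom S (t j) fun k => (j, k)) : i ≠ j := by
  rintro rfl
  exact h rfl

/-- This is the argument for `Forest.join` applied to atoms: the type atoms are pairwise disjoint,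
and the input atom meets each of them in at most its root variable. -/
theorem forest_joinBody {q N : ℕ} {A : Option (RelFact S (Fin N))}
    (hA : ∀ f ∈ A, Function.Injective f.args) (t : Fin N → Tp S q (Fin (n + 1))) :
    Forest {f | f ∈ joinBody A t} := by
  intro f hf k l hkl
  rcases mem_joinBody.1 hf with ⟨g, hg, rfl⟩ | ⟨i, rfl⟩
  · refine hA g hg (hkl.eq_of_const Prod.fst ?_)
    rintro f' ⟨hf', hne⟩ m m'
    rcases mem_joinBody.1 hf' with ⟨g', hg', rfl⟩ | ⟨i, rfl⟩
    · obtain rfl := Option.mem_unique hg' hg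
      exact (hne rfl).elim
    · rfl
  · let r : Fin N × Fin (n + 1) → Fin (n + 1) := fun z => if z.1 = i then z.2 else 0
    have hr : ∀ k, r (i, k) = k := fun k => if_pos rfl
    have hr' : ∀ j k, j ≠ i → r (j, k) = 0 := fun j k h => if_neg h
    have hr0 : ∀ j, r (j, 0) = 0 := fun j => ite_self _
    have := hkl.eq_of_const r ?_
    · exact (hr k).symm.trans (this.trans (hr l))
    · rintro f' ⟨hf', hne⟩ m m'
      rcases mem_joinBody.1 hf' with ⟨g', hg', rfl⟩ | ⟨j, rfl⟩
      · exact (hr0 _).trans (hr0 _).symm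
      · have hji := typeAtom_ne_of_ne hne
        exact (hr' j _ hji).trans (hr' j _ hji).symm

theorem typeProgram_treeShaped (φ : MSOQuery S n) (q N : ℕ) : (typeProgram φ q N).TreeShaped := by
  rintro _ (⟨R, i⟩ | ⟨A, c, t, t', hA, -⟩ | ⟨t, -⟩ | ⟨J, a, -⟩) <;> refine Forest.acyclic ?_
  · have := forest_singleton (f := inAtom S (typeSchema S q n) ⟨R, id⟩) Function.injective_id
    exact this.mono fun f hf => List.mem_singleton.1 hf
  · exact forest_joinBody hA t
  · have := forest_singleton (f := typeAtom S t id) Function.injective_id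
    exact this.mono fun f hf => List.mem_singleton.1 hf
  · intro f hf i
    exact (f.args i).elim

theorem DatalogRule.occurrence_eq {Sin Sout Saux : Schema} {r : DatalogRule Sin Sout Saux}
    (hr : r.body.Nodup) {o o' : r.Occurrence}
    (hinj : Function.Injective (r.body.get o.1).args)
    (hvar : r.body.get o'.1 = r.body.get o.1) (h : r.varAt o' = r.varAt o) : o' = o := by
  obtain ⟨k, l⟩ := o
  obtain ⟨k', l'⟩ := o'
  obtain rfl : k' = k := List.nodup_iff_injective_get.1 hr hvar
  congr 1
  exact hinj h

/-- The root is the articulation position of each type relation. -/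
def rootArticulation (S : Schema) (q n : ℕ) : ArticulationFunction (typeSchema S q n) :=
  fun _ => some (0 : Fin (n + 1))

theorem nodup_joinBody {q N : ℕ} (A : Option (RelFact S (Fin N)))
    (t : Fin N → Tp S q (Fin (n + 1))) : (joinBody A t).Nodup := by
  refine List.Nodup.append ?_ ?_ ?_
  · cases A
    · exact List.nodup_nil
    · exact List.nodup_singleton _
  · refine List.nodup_ofFn.2 fun i j hij => ?_
    have : ∀ f : RelFact (S.sum (typeSchema S q n)) (Fin N × Fin (n + 1)),
        f = typeAtom S (t i) (fun k => (i, k)) → ∀ k, (f.args k).1 = i := by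
      rintro _ rfl k
      rfl
    -- Type atoms always have a root argument, so those of different parts are different.
    exact (this _ hij.symm (0 : Fin (n + 1))).symm
  · intro f hf hf'
    obtain ⟨g, -, rfl⟩ := List.mem_map.1 hf
    obtain ⟨i, hi⟩ := List.mem_ofFn.1 hf'
    have := congrArg RelFact.rel hi
    simp [typeAtom, inAtom] at this

/-- The atom of `joinRule` in which a variable other than a root occurs. -/
theorem eq_typeAtom_of_mem_joinBody {q N : ℕ} {A : Option (RelFact S (Fin N))}
    {t : Fin N → Tp S q (Fin (n + 1))}
    {f : RelFact (S.sum (typeSchema S q n)) (Fin N × Fin (n + 1))} (hf : f ∈ joinBody A t)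
    {l : Fin ((S.sum (typeSchema S q n)).arity f.rel)} (hl : (f.args l).2 ≠ 0) :
    f = typeAtom S (t (f.args l).1) fun k => ((f.args l).1, k) := by
  rcases mem_joinBody.1 hf with ⟨g, hg, rfl⟩ | ⟨i, rfl⟩
  · exact (hl rfl).elim
  · rfl

theorem snd_ne_zero_of_isNonArticulation {q N : ℕ} {A : Option (RelFact S (Fin N))}
    {t : Fin N → Tp S q (Fin (n + 1))}
    {f : RelFact (S.sum (typeSchema S q n)) (Fin N × Fin (n + 1))} (hf : f ∈ joinBody A t)
    {l : Fin ((S.sum (typeSchema S q n)).arity f.rel)}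
    (hl : (rootArticulation S q n).IsNonArticulation f.rel l) : (f.args l).2 ≠ 0 := by
  rcases mem_joinBody.1 hf with ⟨g, hg, rfl⟩ | ⟨i, rfl⟩
  · exact hl.elim
  · exact fun h => hl (congrArg some h.symm)

/-- A variable in a non-articulation position is some `(i, k)` with `k ≠ 0`. It occurs only in the
type atom of part `i`, whereas the articulation position of the head holds the root `(c 0, 0)`. -/
theorem joinRule_almostMonadic {q N : ℕ} (A : Option (RelFact S (Fin N)))
    (c : Fin (n + 1) → Fin N) (t : Fin N → Tp S q (Fin (n + 1))) (t' : Tp S q (Fin (n + 1)))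
    (o : (joinRule A c t t').Occurrence)
    (ho : (rootArticulation S q n).IsNonArticulation ((joinRule A c t t').body.get o.1).rel o.2) :
    (∀ o' : (joinRule A c t t').Occurrence,
      (joinRule A c t t').varAt o' = (joinRule A c t t').varAt o → o' = o) ∧
    (∀ i, (rootArticulation S q n).IsArticulation (joinRule A c t t').head.rel i →
      (joinRule A c t t').head.args i ≠ (joinRule A c t t').varAt o) := by
  have h2 : ((joinRule A c t t').varAt o).2 ≠ 0 :=
    snd_ne_zero_of_isNonArticulation (List.get_mem _ _) ho
  have key : ∀ o' : (joinRule A c t t').Occurrence,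
      (joinRule A c t t').varAt o' = (joinRule A c t t').varAt o →
      (joinRule A c t t').body.get o'.1 =
        typeAtom S (t ((joinRule A c t t').varAt o).1)
          fun k => (((joinRule A c t t').varAt o).1, k) := by
    intro o' h
    rw [← h] at h2 ⊢
    exact eq_typeAtom_of_mem_joinBody (List.get_mem _ _) h2
  refine ⟨fun o' h => DatalogRule.occurrence_eq (nodup_joinBody A t) ?_
    ((key o' h).trans (key o rfl).symm) h, ?_⟩
  · rw [key o rfl]
    exact fun k l h => congrArg Prod.snd h
  · intro i hi h
    obtain rfl : (0 : Fin (n + 1)) = i := Option.some.inj hi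
    rw [← h] at h2
    exact h2 rfl

theorem typeProgram_almostMonadic (φ : MSOQuery S n) (q N : ℕ) :
    (typeProgram φ q N).AlmostMonadic := by
  have hin : ∀ {X : Type} {f : RelFact S X} {A : RelFact (S.sum (typeSchema S q n)) X}
      (l : Fin ((S.sum (typeSchema S q n)).arity A.rel)), A = inAtom S _ f →
      ¬ (rootArticulation S q n).IsNonArticulation A.rel l := by
    rintro X f _ l rfl
    exact id
  refine ⟨rootArticulation S q n, ?_⟩
  rintro _ (⟨R, i⟩ | ⟨A, c, t, t', hA, -⟩ | ⟨t, -⟩ | ⟨J, a, -⟩) o ho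
  · exact (hin _ (List.mem_singleton.1 (List.get_mem _ o.1)) ho).elim
  · exact joinRule_almostMonadic A c t t' o ho
  · refine ⟨fun o' h => DatalogRule.occurrence_eq (List.nodup_singleton _) ?_ ?_ h, ?_⟩
    · rw [List.mem_singleton.1 (List.get_mem _ o.1)]
      exact Function.injective_id
    · rw [List.mem_singleton.1 (List.get_mem _ o.1), List.mem_singleton.1 (List.get_mem _ o'.1)]
    · exact fun i hi => hi.elim
  · obtain ⟨f, -, hf⟩ := List.mem_map.1 (List.get_mem _ o.1)
    exact (hin _ hf.symm ho).elim

end Program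

/-! ### Soundness: derived types are realized by forests over the input. -/

section Soundness

variable {S : Schema} {n q N : ℕ} {φ : MSOQuery S n} {α : Type} {I : Instance S α}

/-- The points `p` are the images of the points of a forest of type `t` that maps to `I`. -/
def HasTypeWitness (I : Instance S α) (t : Tp S q (Fin (n + 1))) (p : Fin (n + 1) → α) : Prop :=
  ∃ (β : Type) (J : Instance S β) (b : Fin (n + 1) → β) (h : β → α), Forest J.facts ∧
    ptp q J b = t ∧ (∀ f ∈ J.facts, f.map h ∈ I.facts) ∧ ∀ k, h (b k) = p k

/-- The meaning of a fact derived by `typeProgram`. -/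
def SoundFact (φ : MSOQuery S n) (q N : ℕ) (I : Instance S α) :
    RelFact (typeProgram φ q N).full α → Prop
  | ⟨.inl R, x⟩ => (⟨R, x⟩ : RelFact S α) ∈ I.facts
  | ⟨.inr (.inl _), x⟩ => ∃ a : Fin n → I.adom, (∀ k, (a k).1 = x k) ∧ φ.Holds I a
  | ⟨.inr (.inr t), x⟩ => HasTypeWitness I t x

/-- The instances behind `Composes` need be neither forests nor related to `I`. They can be replaced
by the forest witnesses of the parts, as the type of a join depends only on the types joined. -/
theorem hasTypeWitness_join {A : Option (RelFact S (Fin N))} {c : Fin (n + 1) → Fin N}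
    {t : Fin N → Tp S q (Fin (n + 1))} {t' : Tp S q (Fin (n + 1))}
    (hA : ∀ f ∈ A, Function.Injective f.args) (ht : Composes A c t t')
    {σ : Fin N × Fin (n + 1) → α} (hσA : ∀ f ∈ A, (f.map fun i => σ (i, 0)) ∈ I.facts)
    (hσ : ∀ i, HasTypeWitness I (t i) fun k => σ (i, k)) :
    HasTypeWitness I t' fun k => σ (c k, k) := by
  obtain ⟨α', I', p, hp, rfl⟩ := ht
  choose β J b h hJ hb hh hhb using hσ
  refine ⟨Σ i, β i, Instance.join A J fun i => b i 0, joinPoints c b, fun z => h z.1 z.2,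
    Forest.join hA hJ, ptp_join_eq A c fun i => (hb i).trans (hp i).symm, ?_, fun k => hhb _ _⟩
  intro f hf
  rcases Instance.mem_join_iff.1 hf with ⟨i, g, hg, rfl⟩ | ⟨g, hg, rfl⟩
  · exact hh i g hg
  · convert hσA g hg using 1
    rw [RelFact.map_map]
    congr 1
    funext i
    exact hhb i 0

theorem holds_of_forest (hφ : φ.TreeDetermined) {β : Type} {J : Instance S β}
    (hJ : Forest J.facts) {b : Fin n → J.adom} (hb : φ.Holds J b) {h : β → α}
    (hh : ∀ f ∈ J.facts, f.map h ∈ I.facts) :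
    ∃ a : Fin n → I.adom, (∀ k, (a k).1 = h (b k).1) ∧ φ.Holds I a :=
  ⟨fun k => (Instance.Hom.ofMap h hh).toFun (b k), fun _ => rfl,
    (hφ α I _).2 ⟨β, J, b, hJ.acyclic, hb, .ofMap h hh, fun _ => rfl⟩⟩

theorem soundFact_of_mem_chase (hq : MSO.rank φ ≤ q) (hφ : φ.TreeDetermined)
    {f : RelFact (typeProgram φ q N).full α} (hf : f ∈ (typeProgram φ q N).chase I) :
    SoundFact φ q N I f := by
  refine (typeProgram φ q N).chase_subset (C := {f | SoundFact φ q N I f}) ?_ ?_ hf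
  · exact fun f hf => hf
  · rintro _ ⟨r, hr, σ, hσ, rfl⟩
    rcases hr with ⟨R, i⟩ | ⟨A, c, t, t', hA, ht⟩ | ⟨t, ht⟩ | ⟨J, a, ha⟩
    · exact ⟨Unit, ⟨∅, Set.finite_empty⟩, fun _ => (), fun _ => σ i, fun f hf => hf.elim, rfl,
        fun f hf => hf.elim, fun _ => rfl⟩
    · refine hasTypeWitness_join (σ := σ) hA ht (fun f hf => ?_) (fun i => ?_)
      · exact hσ _ (mem_joinBody.2 (Or.inl ⟨f, hf, rfl⟩))
      · exact hσ _ (mem_joinBody.2 (Or.inr ⟨i, rfl⟩))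
    · obtain ⟨β', J', b', hb', rfl, hφ'⟩ := ht
      obtain ⟨β, J, b, h, hJ, hb, hh, hhb⟩ :
        HasTypeWitness I (ptp q J' b') σ := hσ _ (List.mem_singleton_self _)
      -- The formula passes from the instance that makes the type accepting to the forest witness of
      -- that type, and then to `I` by tree-determinacy.
      obtain ⟨hb', hφ'⟩ := φ.holds_of_ptp_eq hq hb.symm hb' hφ'
      obtain ⟨a, ha, ha'⟩ := holds_of_forest hφ hJ hφ' hh
      exact ⟨a, fun k => (ha k).trans (hhb k.succ), ha'⟩
    · refine holds_of_forest hφ (h := σ) (fun f _ i => (f.args i).elim) ha fun f hf => ?_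
      exact hσ _ (List.mem_map.2 ⟨f, by simpa using hf, rfl⟩)

end Soundness

/-! ### Completeness: every forest is assembled by joins. -/

section Completeness

variable {S : Schema} {n q N : ℕ} {φ : MSOQuery S n} {β : Type} {J : Instance S β}

/-- `F` with the points `p` is isomorphic, up to isolated values, to a pointed instance whose type
the program derives at `p`. -/
def Built (φ : MSOQuery S n) (q N : ℕ) (J : Instance S β) (F : Set (RelFact S β))
    (p : Fin (n + 1) → β) : Prop :=
  ∃ (κ : Type) (K : Instance S κ) (b : Fin (n + 1) → κ) (h : κ → β),
    (⟨Sum.inr (Sum.inr (ptp q K b)), p⟩ : RelFact (typeProgram φ q N).full β) ∈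
      (typeProgram φ q N).chase J ∧
    (∀ k, h (b k) = p k) ∧ RelFact.map h '' K.facts = F ∧ Set.InjOn h (K.adom ∪ Set.range b)

theorem built_point {x : β} (hx : x ∈ J.adom) : Built φ q N J ∅ fun _ => x := by
  obtain ⟨f, hf, i, rfl⟩ := hx
  refine ⟨Unit, ⟨∅, Set.finite_empty⟩, fun _ => (), fun _ => f.args i, ?_, fun _ => rfl,
    Set.image_empty _, fun _ _ _ _ _ => rfl⟩
  refine (typeProgram φ q N).head_mem_chase (r := pointRule q n f.rel i) (.point f.rel i) f.args ?_
  intro A hA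
  obtain rfl := List.mem_singleton.1 hA
  exact (typeProgram φ q N).ofIn_mem_chase hf

/-- Building a set of facts from the parts given by a partition `ρ` of the values. -/
theorem built_join {A : Option (RelFact S (Fin N))} (hA : ∀ g ∈ A, Function.Injective g.args)
    (ρ : β → Fin N) {F : Fin N → Set (RelFact S β)} {p : Fin (n + 1) → β}
    {p' : Fin N → Fin (n + 1) → β} (hF : ∀ i, ∀ f ∈ F i, ∀ l, ρ (f.args l) = i)
    (hp : ∀ k, p' (ρ (p k)) k = p k) (hAJ : ∀ g ∈ A, (g.map fun i => p' i 0) ∈ J.facts)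
    (hAρ : ∀ g ∈ A, ∀ l, ρ (p' (g.args l) 0) = g.args l)
    (hB : ∀ i, Built φ q N J (F i) (p' i)) :
    Built φ q N J ((⋃ i, F i) ∪ {f | ∃ g ∈ A, f = g.map fun i => p' i 0}) p := by
  choose κ K b h hT hb hK hinj using hB
  have hroot : ∀ g : RelFact S (Fin N),
      (g.map fun i => (⟨i, b i 0⟩ : Σ i, κ i)).map (fun z => h z.1 z.2) =
        g.map fun i => p' i 0 := by
    intro g
    rw [RelFact.map_map]
    congr 1
    funext i
    exact hb i 0
  refine ⟨Σ i, κ i, Instance.join A K fun i => b i 0, joinPoints (fun k => ρ (p k)) b,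
    fun z => h z.1 z.2, ?_, fun k => (hb _ _).trans (hp k), ?_, ?_⟩
  · have := (typeProgram φ q N).head_mem_chase (I := J)
      (r := joinRule A (fun k => ρ (p k)) (fun i => ptp q (K i) (b i)) _)
      (.join A _ _ _ hA ⟨κ, K, b, fun _ => rfl, rfl⟩) (fun z => p' z.1 z.2) ?_
    · convert this using 1
      have hp' : p = fun k => p' (ρ (p k)) k := funext fun k => (hp k).symm
      exact congrArg (RelFact.mk (S := (typeProgram φ q N).full) _) hp'
    · intro B hB
      rcases mem_joinBody.1 hB with ⟨g, hg, rfl⟩ | ⟨i, rfl⟩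
      · exact (typeProgram φ q N).ofIn_mem_chase (hAJ g hg)
      · exact hT i
  · ext f
    constructor
    · rintro ⟨f, hf, rfl⟩
      rcases Instance.mem_join_iff.1 hf with ⟨i, g, hg, rfl⟩ | ⟨g, hg, rfl⟩
      · exact Or.inl (Set.mem_iUnion.2 ⟨i, hK i ▸ ⟨g, hg, rfl⟩⟩)
      · exact Or.inr ⟨g, hg, hroot g⟩
    · rintro (hf | ⟨g, hg, rfl⟩)
      · obtain ⟨i, hf⟩ := Set.mem_iUnion.1 hf
        rw [← hK i] at hf
        obtain ⟨g, hg, rfl⟩ := hf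
        exact ⟨_, Instance.mem_join_iff.2 (Or.inl ⟨i, g, hg, rfl⟩), rfl⟩
      · exact ⟨_, Instance.mem_join_iff.2 (Or.inr ⟨g, hg, rfl⟩), hroot g⟩
  -- `ρ` recovers the part from the image of a value, so different parts do not collide. Unused
  -- roots may collide, but they are isolated and not among the points.
  · have key : ∀ z ∈ (Instance.join A K fun i => b i 0).adom ∪
        Set.range (joinPoints (fun k => ρ (p k)) b),
        ρ (h z.1 z.2) = z.1 ∧ z.2 ∈ (K z.1).adom ∪ Set.range (b z.1) := by
      rintro ⟨i, x⟩ (hz | ⟨k, hk⟩)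
      · rcases Instance.mem_adom_join_iff.1 hz with hx | ⟨rfl, g, hg, l, rfl⟩
        · refine ⟨?_, Or.inl hx⟩
          obtain ⟨g, hg, l, rfl⟩ := hx
          exact hF i (g.map (h i)) (hK i ▸ ⟨g, hg, rfl⟩) l
        · refine ⟨?_, Or.inr ⟨0, rfl⟩⟩
          simp only [hb]
          exact hAρ g hg l
      · rw [← hk]
        refine ⟨?_, Or.inr ⟨k, rfl⟩⟩
        simp only [joinPoints, hb, hp]
    rintro ⟨i, x⟩ hz ⟨j, y⟩ hw hzw
    obtain ⟨h1, h2⟩ := key _ hz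
    obtain ⟨h3, h4⟩ := key _ hw
    simp only at h1 h2 h3 h4 hzw
    obtain rfl : i = j := by rw [← h1, ← h3, hzw]
    rw [hinj i h2 h4 hzw]

/-- Points may coincide while the parts of a join are disjoint. Hence there is one single-point part
for each distinct value of `p`, indexed by a chosen position of that value; surplus parts hold `p
0`. -/
theorem built_empty (hN : n + 1 ≤ N) {p : Fin (n + 1) → β} (hp : ∀ k, p k ∈ J.adom) :
    Built φ q N J ∅ p := by
  classical
  let ρ : β → Fin N := fun x => if h : ∃ k, p k = x then Fin.castLE hN h.choose else
    Fin.castLE hN 0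
  let p' : Fin N → Fin (n + 1) → β := fun i _ => if h : i.1 < n + 1 then p ⟨i, h⟩ else p 0
  have := built_join (φ := φ) (q := q) (J := J) (A := none) (by simp) ρ (F := fun _ => ∅)
    (p := p) (p' := p') (by simp) ?_ (by simp) (by simp) ?_
  · simpa using this
  · intro k
    have hk : ∃ l, p l = p k := ⟨k, rfl⟩
    have h1 : ρ (p k) = Fin.castLE hN hk.choose := dif_pos hk
    have h2 : (ρ (p k)).1 < n + 1 := by
      rw [h1]
      exact hk.choose.2
    have h3 : (⟨ρ (p k), h2⟩ : Fin (n + 1)) = hk.choose := by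
      ext
      exact congrArg (fun i : Fin N => i.1) h1
    simp only [p', h2, dite_true, h3]
    exact hk.choose_spec
  · intro i
    refine built_point ?_
    split_ifs
    · exact hp _
    · exact hp _

/-- Induction on the number of facts. Removing a fact `f` separates its arguments; the component of
the `l`-th argument goes to part `l`, everything else to one further part, whence the strict bound
on arities. The parts are built by induction and joined by `f`. -/
theorem built_of_forest (hN : n + 1 ≤ N) (hS : ∀ R, S.arity R < N) (hJ : Forest J.facts)
    {F : Set (RelFact S β)} (hF : F ⊆ J.facts) {p : Fin (n + 1) → β} (hp : ∀ k, p k ∈ J.adom) :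
    Built φ q N J F p := by
  classical
  induction hm : F.ncard using Nat.strong_induction_on generalizing F p with
  | _ m ih =>
  rcases F.eq_empty_or_nonempty with rfl | ⟨f₀, hf₀⟩
  · exact built_empty hN hp
  -- The joining fact meets each part only at its root, so `f` should contain `p 0` whenever some
  -- fact does.
  obtain ⟨f, hf, hfp⟩ : ∃ f ∈ F, (∃ l, f.args l = p 0) ∨ ∀ g ∈ F, ∀ l, g.args l ≠ p 0 := by
    by_cases h : ∃ f ∈ F, ∃ l, f.args l = p 0
    · obtain ⟨f, hf, h⟩ := h
      exact ⟨f, hf, Or.inl h⟩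
    · push Not at h
      exact ⟨f₀, hf₀, Or.inr h⟩
  have hFf : Forest F := hJ.mono hF
  have hfin : F.Finite := J.finite.subset hF
  have hr := hS f.rel
  let inc : Fin (S.arity f.rel) → Fin N := Fin.castLE hr.le
  have hinc : Function.Injective inc := Fin.castLE_injective _
  let ρ : β → Fin N := fun x => if h : ∃ l, Conn (F \ {f}) x (f.args l) then inc h.choose else
    ⟨S.arity f.rel, hr⟩
  have ρ_eq : ∀ x l, Conn (F \ {f}) x (f.args l) → ρ x = inc l := by
    intro x l hl
    have h : ∃ l, Conn (F \ {f}) x (f.args l) := ⟨l, hl⟩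
    have h1 : ρ x = inc h.choose := dif_pos h
    rw [h1, hFf f hf _ _ (h.choose_spec.symm.trans hl)]
  have ρ_inc : ∀ x l, ρ x = inc l → Conn (F \ {f}) x (f.args l) := by
    intro x l hl
    by_cases h : ∃ l, Conn (F \ {f}) x (f.args l)
    · have h1 : ρ x = inc h.choose := dif_pos h
      rw [← hinc (h1.symm.trans hl)]
      exact h.choose_spec
    · have h1 : ρ x = ⟨S.arity f.rel, hr⟩ := dif_neg h
      have := congrArg Fin.val (h1.symm.trans hl)
      exact absurd this l.2.ne'
  have ρ_conn : ∀ x y, Conn (F \ {f}) x y → ρ x = ρ y := by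
    intro x y hxy
    by_cases h : ∃ l, Conn (F \ {f}) x (f.args l)
    · obtain ⟨l, hl⟩ := h
      rw [ρ_eq x l hl, ρ_eq y l (hxy.symm.trans hl)]
    · have h' : ¬ ∃ l, Conn (F \ {f}) y (f.args l) := fun ⟨l, hl⟩ => h ⟨l, hxy.trans hl⟩
      simp only [ρ, h, h', dite_false]
  -- Nullary facts belong to no component and go to the further part.
  let reg : RelFact S β → Fin N := fun g => if h : 0 < S.arity g.rel then ρ (g.args ⟨0, h⟩) else
    ⟨S.arity f.rel, hr⟩
  let base : Fin N → β := fun i => if h : i.1 < S.arity f.rel then f.args ⟨i, h⟩ else p 0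
  -- Points lying in other parts are replaced by a default, which for part `l` is the `l`-th
  -- argument of `f`.
  let p' : Fin N → Fin (n + 1) → β := fun i k => if ρ (p k) = i then p k else base i
  have base_inc : ∀ l, base (inc l) = f.args l := by
    intro l
    have : (inc l).1 < S.arity f.rel := l.2
    simp only [base, this, dite_true]
    rfl
  have base_adom : ∀ i, base i ∈ J.adom := by
    intro i
    simp only [base]
    split_ifs
    · exact ⟨f, hF hf, _, rfl⟩
    · exact hp 0
  -- If `p 0` lies in part `l`, it must equal the `l`-th argument: either it is an argument of `f`
  -- and the forest property applies, or it occurs in no fact and is connected only to itself.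
  have root_inc : ∀ l, p' (inc l) 0 = f.args l := by
    intro l
    simp only [p', base_inc]
    split_ifs with h
    · have hc := ρ_inc _ _ h
      rcases hfp with ⟨l', hl'⟩ | hfp
      · rw [← hl'] at hc ⊢
        rw [hFf f hf _ _ hc]
      · have := hc.eq_of_const (fun x => x = p 0) ?_
        · exact (this.mp rfl).symm
        · intro g hg i j
          simp only [hfp g hg.1]
    · rfl
  have hunion : ((⋃ i, {g ∈ F \ {f} | reg g = i}) ∪
      {f' | ∃ g ∈ some (⟨f.rel, inc⟩ : RelFact S (Fin N)), f' = g.map fun i => p' i 0}) = F := by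
    have hmap : (⟨f.rel, inc⟩ : RelFact S (Fin N)).map (fun i => p' i 0) = f := by
      simp only [RelFact.map, root_inc]
    ext g
    simp only [Set.mem_union, Set.mem_iUnion, Set.mem_ofPred_eq, Option.mem_some_iff,
      exists_eq_left', hmap, exists_and_left, exists_eq', and_true, Set.mem_sdiff,
      Set.mem_singleton_iff]
    by_cases h : g = f
    · simp [h, hf]
    · simp [h]
  rw [← hunion]
  refine built_join ?_ ρ ?_ ?_ ?_ ?_ ?_
  · rintro _ ⟨⟩
    exact hinc
  · rintro i g ⟨hg, hgi⟩ l
    have hl : 0 < S.arity g.rel := l.pos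
    simp only [reg, hl, dite_true] at hgi
    rw [← hgi]
    exact ρ_conn _ _ (Conn.of_mem hg _ _)
  · intro k
    exact if_pos rfl
  · rintro _ ⟨⟩
    convert hF hf using 1
    simp only [RelFact.map, root_inc]
  · rintro _ ⟨⟩ l
    change ρ (p' (inc l) 0) = inc l
    rw [root_inc]
    exact ρ_eq _ _ (Conn.refl _ _)
  · intro i
    have hsub : {g ∈ F \ {f} | reg g = i} ⊆ F := fun g hg => hg.1.1
    refine ih _ ?_ (hsub.trans hF) (fun k => ?_) rfl
    · rw [← hm]
      refine Set.ncard_lt_ncard ⟨hsub, fun h => ?_⟩ hfin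
      exact (h hf).1.2 rfl
    · simp only [p']
      split_ifs
      · exact hp k
      · exact base_adom i

/-- With a nonempty active domain, any element serves as the root and the type of the whole forest
is accepting. With an empty one there is no root, which is why the nullary rules exist. -/
theorem mem_chase_of_forest (hN : n + 1 ≤ N) (hS : ∀ R, S.arity R < N) (hJ : Forest J.facts)
    {b : Fin n → J.adom} (hb : φ.Holds J b) :
    (⟨Sum.inr (Sum.inl ()), fun k => (b k).1⟩ : RelFact (typeProgram φ q N).full β) ∈
      (typeProgram φ q N).chase J := by
  rcases J.adom.eq_empty_or_nonempty with hJe | ⟨x, hx⟩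
  · have hem : IsEmpty J.adom := Set.isEmpty_coe_sort.2 hJe
    -- Moving to `Empty` makes the instance one of the finitely many behind the nullary rules.
    let J' : Instance S Empty :=
      ⟨{f | f.map Empty.elim ∈ J.facts}, Set.toFinite _⟩
    let a : Fin n → J'.adom := fun k => (hem.false (b k)).elim
    have himg : RelFact.map Empty.elim '' J'.facts = J.facts := by
      refine Set.Subset.antisymm ?_ fun f hf => ?_
      · rintro _ ⟨f, hf, rfl⟩
        exact hf
      · have hfe : f = RelFact.map Empty.elim
            ⟨f.rel, fun i => (hem.false (J.arg ⟨f, hf⟩ i)).elim⟩ := by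
          refine congrArg (RelFact.mk f.rel) (funext fun i => ?_)
          exact (hem.false (J.arg ⟨f, hf⟩ i)).elim
        rw [hfe] at hf ⊢
        exact ⟨_, hf, rfl⟩
    have ha : φ.Holds J' a := (MSOQuery.holds_iff_of_image_eq (h := Empty.elim)
      (fun x => x.elim) himg φ fun k => (hem.false (b k)).elim).2 hb
    have := (typeProgram φ q N).head_mem_chase (I := J) (.nullary J' a ha) Empty.elim ?_
    · convert this using 1
      refine congrArg (RelFact.mk (S := (typeProgram φ q N).full) _) (funext fun k => ?_)
      exact (hem.false (b k)).elim
    · intro A hA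
      obtain ⟨f, hf, rfl⟩ := List.mem_map.1 hA
      exact (typeProgram φ q N).ofIn_mem_chase (f := f.map Empty.elim)
        (J'.finite.mem_toFinset.1 (Finset.mem_toList.1 hf))
  · let p : Fin (n + 1) → β := Fin.cons x fun k => (b k).1
    have hp : ∀ k, p k ∈ J.adom := by
      intro k
      cases k using Fin.cases with
      | zero => exact hx
      | succ k => exact (b k).2
    obtain ⟨κ, K, c, h, hT, hc, hK, hinj⟩ :=
      built_of_forest (φ := φ) (q := q) hN hS hJ subset_rfl hp
    have hcK : ∀ k : Fin n, c k.succ ∈ K.adom := by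
      intro k
      obtain ⟨f, hf, i, hi⟩ := (b k).2
      rw [← hK] at hf
      obtain ⟨g, hg, rfl⟩ := hf
      have : c k.succ = g.args i :=
        hinj (Or.inr ⟨_, rfl⟩) (Or.inl ⟨g, hg, i, rfl⟩) ((hc k.succ).trans hi.symm)
      exact this ▸ ⟨g, hg, i, rfl⟩
    have hφ : φ.Holds K fun k => ⟨c k.succ, hcK k⟩ :=
      (MSOQuery.holds_iff_of_image_eq (hinj.mono Set.subset_union_left) hK φ
        fun k => hc k.succ).2 hb
    refine (typeProgram φ q N).head_mem_chase (I := J) (r := outRule (ptp q K c))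
      (TypeRule.out _ ⟨κ, K, c, hcK, rfl, hφ⟩) p fun A hA => ?_
    obtain rfl := List.mem_singleton.1 hA
    exact hT

end Completeness

theorem MSOQuery.TreeDetermined.definableIn {S : Schema} {n : ℕ} {φ : MSOQuery S n}
    (hφ : φ.TreeDetermined) : φ.DefinableIn DatalogProgram.IsTAM := by
  have := S.finite
  obtain ⟨M, hM⟩ := (Set.finite_range S.arity).bddAbove
  have hS : ∀ R, S.arity R < n + 1 + M := fun R => by
    have := hM ⟨R, rfl⟩
    omega
  have hN : n + 1 ≤ n + 1 + M := Nat.le_add_right _ _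
  -- `n + 1` parts suffice to separate the points, and adding the arity bound `M` leaves room for
  -- the arguments of a fact and one further part.
  refine ⟨typeProgram φ (MSO.rank φ) (n + 1 + M),
    ⟨typeProgram_treeShaped _ _ _, typeProgram_almostMonadic _ _ _⟩, (), rfl, fun α I a => ?_⟩
  constructor
  · intro h
    obtain ⟨a', ha', hI⟩ : ∃ a' : Fin n → I.adom, (∀ k, (a' k).1 = (a k).1) ∧ φ.Holds I a' :=
      soundFact_of_mem_chase le_rfl hφ h
    obtain rfl : a' = a := funext fun k => Subtype.ext (ha' k)
    exact hI
  · intro h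
    obtain ⟨β, J, b, hJ, hb, k, hk⟩ := (hφ α I a).1 h
    obtain rfl : (fun i => k.toFun (b i)) = a := funext hk
    exact (typeProgram φ _ _).map_hom_mem_chase k (f := ⟨Sum.inr (Sum.inl ()), b⟩)
      (mem_chase_of_forest hN hS hJ.forest hb)

theorem mainTheorem2 (S : Schema) (n : ℕ) (φ : MSOQuery S n) :
    List.TFAE [
      φ.DefinableIn DatalogProgram.IsTAM,
      φ.DefinableIn DatalogProgram.TreeShaped,
      φ.TreeDetermined] := by
  tfae_have 1 → 2 := fun ⟨P, hP, h⟩ => ⟨P, hP.1, h⟩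
  tfae_have 2 → 3 := fun h => h.treeDetermined
  tfae_have 3 → 1 := fun h => h.definableIn
  tfae_finish
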